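/- Notation. For a positive integer $n$, $\mathbb{R}^n$ carries its Euclidean structure, $B(x,\rho)$ is the closed ball, and for $\delta>0$ and bounded $A\subset\mathbb{R}^n$, $\mathcal{N}_\delta(A)$ is the minimal number of closed balls of radius $\delta$ (with arbitrary centres) needed to cover $A$. For $0<m<n$, $\mathrm{Gr}(\mathbb{R}^n,m)$ is the Grassmannian of $m$-dimensional linear subspaces (with its usual topology and Borel $\sigma$-algebra), and $\pi_V$ is the orthogonal projection onto $V$. For $V\in\mathrm{Gr}(\mathbb{R}^n,m)$ and $W\in\mathrm{Gr}(\mathbb{R}^n,n-m)$ put $d_\measuredangle(V,W)=|\det(v_1,\dots,v_m,w_1,\dots,w_{n-m})|$, where $(v_i)$ and $(w_j)$ are orthonormal bases of $V$ and $W$, and $\mathcal{V}_\measuredangle(W,\rho)=\{V\in\mathrm{Gr}(\mathbb{R}^n,m) : d_\measuredangle(V,W)\le\rho\}$. For bounded $A\subset\mathbb{R}^n$ and parameters $\delta,\alpha,\epsilon$ put $$\mathcal{E}(A,\epsilon)=\bigl\{V\in\mathrm{Gr}(\mathbb{R}^n,m) : \exists A'\subset A,\ \mathcal{N}_\delta(A')\ge\delta^{\epsilon}\mathcal{N}_\delta(A)\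 \text{and}\ \mathcal{N}_\delta(\pi_V(A'))<\delta^{-\frac mn\alpha-\epsilon}\bigr\}.$$ For integers $0<m<n$ let $\mathrm{P}(n,m)$ be the following statement. For all $0<\alpha<n$ and $\kappa>0$ there exist $\epsilon>0$ and $\delta_0>0$ such that for every $0<\delta<\delta_0$, every subset $A\subset B(0,1)$ of $\mathbb{R}^n$ and every probability measure $\mu$ on $\mathrm{Gr}(\mathbb{R}^n,m)$ satisfying 1. $\mathcal{N}_\delta(A)\ge\delta^{-\alpha+\epsilon}$, 2. $\mathcal{N}_\delta(A\cap B(x,\rho))\le\delta^{-\epsilon}\rho^{\kappa}\mathcal{N}_\delta(A)$ for all $\rho\ge\delta$ and all $x\in\mathbb{R}^n$, 3. $\mu(\mathcal{V}_\measuredangle(W,\rho))\le\delta^{-\epsilon}\rho^{\kappa}$ for all $\rho\ge\delta$ and all $W\in\mathrm{Gr}(\mathbb{R}^n,n-m)$, there exists a subset $A'\subset A$ such that $\mu(\mathcal{E}(A',\epsilon))\le\delta^{\epsilon}$ (where $\mu$ is understood as an outer measure if the set is not measurable). Proposition. Let $m\ge1$ and $q\ge3$ be integers. If $\mathrm{P}((q-1)m,m)$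 holds, then $\mathrm{P}(qm,m)$ holds. -/

import Mathlib

open MeasureTheory

namespace HigherRankProjection

/-- `ℝⁿ` with its usual Euclidean structure. -/
abbrev E (n : ℕ) : Type := EuclideanSpace ℝ (Fin n)

/-- The Grassmannian `Gr(ℝⁿ, m)` of `m`-dimensional linear subspaces of `ℝⁿ`. -/
def Gr (n m : ℕ) : Type := {V : Submodule ℝ (E n) // Module.finrank ℝ V = m}

namespace Gr

variable {n m : ℕ}

/-- The orthogonal projection `π_V` onto `V`, as a continuous linear map `ℝⁿ → ℝⁿ`. -/
noncomputable def proj (V : Gr n m) : E n →L[ℝ] E n := V.1.starProjection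

/-- The usual topology of the Grassmannian: the one for which `V ↦ π_V` is a homeomorphism onto
its image in the space of endomorphisms. -/
noncomputable instance : TopologicalSpace (Gr n m) :=
  TopologicalSpace.induced proj inferInstance

/-- The Borel sigma-algebra of the Grassmannian. -/
noncomputable instance : MeasurableSpace (Gr n m) := borel (Gr n m)

instance : BorelSpace (Gr n m) := ⟨rfl⟩

/-- Some orthonormal basis of the `m`-dimensional subspace `V`. -/
noncomputable def onb (V : Gr n m) : OrthonormalBasis (Fin m) ℝ V.1 :=
  (stdOrthonormalBasis ℝ V.1).reindex (finCongr V.2)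

end Gr

/-- The list of `n = m + k` vectors `(v_1, …, v_m, w_1, …, w_k)`. -/
def concat {n m k : ℕ} (h : m + k = n) (v : Fin m → E n) (w : Fin k → E n) : Fin n → E n :=
  fun i => Fin.append v w (Fin.cast h.symm i)

/-- `d_∡(V, W) = |det (v_1, …, v_m, w_1, …, w_k)|` for subspaces `V`, `W` of `ℝⁿ` of complementary
dimensions `m + k = n`, where `(v_i)` is an orthonormal basis of `V` and `(w_j)` an orthonormal
basis of `W`. By `dang_eq` below it does not depend on the choice of these bases. -/
noncomputable def dang {n m k : ℕ} (h : m + k = n) (V : Gr n m) (W : Gr n k) : ℝ :=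
  |(EuclideanSpace.basisFun (Fin n) ℝ).toBasis.det
    (concat h (fun i => (V.onb i : E n)) (fun j => (W.onb j : E n)))|

/-- `d_∡` does not depend on the orthonormal bases. -/
theorem dang_eq {n m k : ℕ} (h : m + k = n) (V : Gr n m) (W : Gr n k)
    (v : OrthonormalBasis (Fin m) ℝ V.1) (w : OrthonormalBasis (Fin k) ℝ W.1) :
    dang h V W = |(EuclideanSpace.basisFun (Fin n) ℝ).toBasis.det
      (concat h (fun i => (v i : E n)) (fun j => (w j : E n)))| := by
  subst h
  set b := (EuclideanSpace.basisFun (Fin (m + k)) ℝ).toBasis with hb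
  have key : ∀ (v : OrthonormalBasis (Fin m) ℝ V.1) (w : OrthonormalBasis (Fin k) ℝ W.1),
      b.det (concat rfl (fun i => (v i : E (m + k))) (fun j => (w j : E (m + k)))) =
        ((Matrix.fromCols (Matrix.of fun i j => b.repr (v j : E (m + k)) i)
          (Matrix.of fun i j => b.repr (w j : E (m + k)) i)).submatrix
            finSumFinEquiv id).det := by
    intro v w
    rw [Module.Basis.det_apply, ← Matrix.det_submatrix_equiv_self finSumFinEquiv]
    congr 1
    ext i j
    rcases j with j | j <;> simp [Module.Basis.toMatrix_apply, concat, Matrix.fromCols]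
  have expand : ∀ {l : ℕ} (U : Gr (m + k) l) (u u' : OrthonormalBasis (Fin l) ℝ U.1),
      (Matrix.of fun i j => b.repr (u j : E (m + k)) i) =
        (Matrix.of fun i j => b.repr (u' j : E (m + k)) i) * u'.toBasis.toMatrix u := by
    intro l U u u'
    ext i j
    have h1 := u'.toBasis.sum_toMatrix_smul_self u j
    have h2 := congrArg (fun x : U.1 => b.repr (x : E (m + k)) i) h1
    simp only [Submodule.coe_sum, Submodule.coe_smul, map_sum, map_smul, Finsupp.coe_finsetSum,
      Finset.sum_apply, Finsupp.smul_apply, smul_eq_mul] at h2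
    rw [Matrix.mul_apply, Matrix.of_apply, ← h2]
    refine Finset.sum_congr rfl fun c _ => ?_
    simp [mul_comm]
  have habs : ∀ {l : ℕ} (U : Gr (m + k) l) (u u' : OrthonormalBasis (Fin l) ℝ U.1),
      |(u'.toBasis.toMatrix u).det| = 1 := by
    intro l U u u'
    have := u'.det_to_matrix_orthonormalBasis_real u
    rw [Module.Basis.det_apply] at this
    rcases this with h | h <;> rw [h] <;> simp
  unfold dang
  rw [key, key, expand V V.onb v, expand W W.onb w]
  have hblock : ∀ (M : Matrix (Fin (m + k)) (Fin m) ℝ) (N : Matrix (Fin (m + k)) (Fin k) ℝ)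
      (P : Matrix (Fin m) (Fin m) ℝ) (Q : Matrix (Fin k) (Fin k) ℝ),
      (Matrix.fromCols (M * P) (N * Q)).submatrix finSumFinEquiv id =
        (Matrix.fromCols M N).submatrix finSumFinEquiv id * Matrix.fromBlocks P 0 0 Q := by
    intro M N P Q
    ext i j
    rcases j with j | j <;> simp [Matrix.mul_apply, Matrix.fromCols, Matrix.fromBlocks]
  rw [hblock, Matrix.det_mul, Matrix.det_fromBlocks_zero₂₁, abs_mul, abs_mul, habs, habs]
  simp

/-- `𝒱_∡(W, ρ)`: the set of all `V ∈ Gr(ℝⁿ, m)` with `d_∡(V, W) ≤ ρ`. -/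
def Vang {n m k : ℕ} (h : m + k = n) (W : Gr n k) (ρ : ℝ) : Set (Gr n m) :=
  {V | dang h V W ≤ ρ}

/-- `𝒩_δ(A)`: the minimal number of closed balls of radius `δ` needed to cover `A` (used only for
`δ > 0` and bounded `A`, when it is finite). -/
noncomputable def Ncov {n : ℕ} (δ : ℝ) (A : Set (E n)) : ℕ :=
  (Metric.externalCoveringNumber δ.toNNReal A).toNat

/-- `𝒩_δ(A)` is the minimal number of balls: some `𝒩_δ(A)` balls cover `A`, and no smaller number
of balls does. -/
theorem isLeast_Ncov {n : ℕ} {δ : ℝ} (hδ : 0 < δ) {A : Set (E n)} (hA : Bornology.IsBounded A) :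
    IsLeast {N : ℕ | ∃ s : Finset (E n), s.card = N ∧ A ⊆ ⋃ x ∈ s, Metric.closedBall x δ}
      (Ncov δ A) := by
  have hd : ((δ.toNNReal : NNReal) : ℝ) = δ := Real.coe_toNNReal δ hδ.le
  have lower : ∀ s : Finset (E n), A ⊆ ⋃ x ∈ s, Metric.closedBall x δ →
      Metric.externalCoveringNumber δ.toNNReal A ≤ (s.card : ℕ∞) := by
    intro s hs
    have : Metric.IsCover δ.toNNReal A (s : Set (E n)) := by
      rw [Metric.isCover_iff_subset_iUnion_closedBall, hd]
      simpa using hs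
    simpa using this.externalCoveringNumber_le_encard
  have hpos : δ.toNNReal ≠ 0 := by
    rw [ne_eq, Real.toNNReal_eq_zero]; linarith
  obtain ⟨N, -, hN, hcov⟩ := Metric.exists_finite_isCover_of_totallyBounded hpos
    (hA.isCompact_closure.totallyBounded.subset subset_closure)
  have hne : Metric.externalCoveringNumber δ.toNNReal A ≠ ⊤ :=
    ne_top_of_le_ne_top (Set.encard_ne_top_iff.2 hN) hcov.externalCoveringNumber_le_encard
  constructor
  · have hex : ∃ C : Set (E n), Metric.IsCover δ.toNNReal A C ∧
        C.encard = Metric.externalCoveringNumber δ.toNNReal A := by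
      have : Nonempty {C : Set (E n) // Metric.IsCover δ.toNNReal A C} := ⟨⟨N, hcov⟩⟩
      obtain ⟨C, hC⟩ := ENat.exists_eq_iInf
        (fun C : {C : Set (E n) // Metric.IsCover δ.toNNReal A C} => (C : Set (E n)).encard)
      refine ⟨C, C.2, ?_⟩
      rw [hC, iInf_subtype]
      rfl
    obtain ⟨C, hC, hcard⟩ := hex
    have hfin : C.Finite := Set.encard_ne_top_iff.1 (hcard ▸ hne)
    refine ⟨hfin.toFinset, ?_, ?_⟩
    · rw [Ncov, ← hcard, hfin.encard_eq_coe_toFinset_card]; simp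
    · rw [Metric.isCover_iff_subset_iUnion_closedBall, hd] at hC
      simpa using hC
  · rintro N ⟨s, rfl, hs⟩
    exact ENat.toNat_le_of_le_natCast (lower s hs)

/-- The set `ℰ(A, ε)` of exceptional directions at scale `δ`, for the parameter `α`. -/
def EC {n m : ℕ} (δ α : ℝ) (A : Set (E n)) (ε : ℝ) : Set (Gr n m) :=
  {V | ∃ A' ⊆ A, δ ^ ε * (Ncov δ A : ℝ) ≤ (Ncov δ A' : ℝ) ∧
    (Ncov δ (V.proj '' A') : ℝ) < δ ^ (-((m : ℝ) / (n : ℝ)) * α - ε)}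

/-- The discretized projection theorem in the dimensions `0 < m < n` (as a proposition). -/
def ProjectionTheorem (n m : ℕ) : Prop :=
  ∀ (_hm : 0 < m) (hmn : m < n) (α κ : ℝ), 0 < α → α < n → 0 < κ →
    ∃ ε : ℝ, 0 < ε ∧ ∃ δ₀ : ℝ, 0 < δ₀ ∧ ∀ δ : ℝ, 0 < δ → δ < δ₀ →
      ∀ (A : Set (E n)) (μ : Measure (Gr n m)),
        A ⊆ Metric.closedBall 0 1 →
        IsProbabilityMeasure μ →
        δ ^ (-α + ε) ≤ (Ncov δ A : ℝ) →
        (∀ ρ : ℝ, δ ≤ ρ → ∀ x : E n,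
          (Ncov δ (A ∩ Metric.closedBall x ρ) : ℝ) ≤ δ ^ (-ε) * ρ ^ κ * (Ncov δ A : ℝ)) →
        (∀ ρ : ℝ, δ ≤ ρ → ∀ W : Gr n (n - m),
          μ.real (Vang (Nat.add_sub_of_le hmn.le) W ρ) ≤ δ ^ (-ε) * ρ ^ κ) →
        ∃ A' ⊆ A, μ.real (EC δ α A' ε) ≤ δ ^ ε

end HigherRankProjection

/-!
The induction step of the discretized projection theorem: from dimension `l = (q - 1) m` to dimension
`n = q m`, always for projections to `m`-dimensional subspaces.

Suppose that the conclusion fails for `A` with a small exponent `ε`. Then *every* subset of `A` has many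
exceptional directions, so directions `V 0, …, V (q - 1)` can be chosen one after the other, each
exceptional for the subset of `A` produced so far and at an angle at least `δ ^ O(ε)` with the span of
the previous ones (`exists_quantitatively_independent`). In the end a subset `F` with
`|F| ≥ δ ^ (q ε) |A|` has projections of size at most about `δ ^ (-α / q)` in all the directions `V i`,
and `F` essentially lies in the grid spanned by these projections (`card_le_of_slice`).
Consequently most slices of `F` along `U = V 0` have size about `δ ^ (-α (q - 1) / q)`, the largest
size that the grid permits.

These slices live in `Uᗮ`, of dimension `l`, and the hypothesis applies to them with exponent
`α (q - 1) / q` and with the directions `Φ V`, the images of `V` under the projection to `Uᗮ`: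

* The image of `μ` under `Φ` satisfies the angle condition because `d_∡(V, U ⊕ W') ≤ d_∡(Φ V, W')`
  (`exists_preimage_Vang_subset`).
* The slices do not concentrate in small balls. By the grid bound it is enough that `V 1` has no heavy
  tubes, which holds for most directions by a second moment computation in the style of Kaufman
  (`measureReal_heavy_tube_mul_sq_le`): if `π_V a` and `π_V a'` are close although `a` and `a'` are
  not, then `V` makes a small angle with a subspace orthogonal to `a - a'`.

The hypothesis controls the exceptional directions of some subset of a slice only, but an exhaustion
argument turns this into a bound for the slice itself (`ProjectionTheorem.measure_EC_le`). On the other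
hand, a direction that is exceptional for `F` is exceptional for many of its slices, since
`‖π_V y‖ ≥ d_∡(V, W) ‖π_{Φ V} y‖` for `y ∈ Uᗮ` and `W ⊇ U`. Averaging over the slices
(`measureReal_le_of_parts`) bounds the measure of the exceptional directions of `F`, a contradiction.

Throughout, sets are replaced by finite sets whose points are more than `2 δ` apart; for these `Ncov` is
the cardinality. Exceptional sets are not known to be measurable, so that Markov's inequality is
applied to measurable hulls.
-/

namespace HigherRankProjection

variable {n m k l : ℕ} {δ : ℝ}

open scoped InnerProductSpace Topology

/-! ### Covering numbers and separated sets -/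

theorem exists_finset_cover (hδ : 0 < δ) {A : Set (E n)} (hA : Bornology.IsBounded A) :
    ∃ t : Finset (E n), t.card = Ncov δ A ∧ ∀ a ∈ A, ∃ c ∈ t, dist a c ≤ δ := by
  obtain ⟨t, ht, hcov⟩ := (isLeast_Ncov hδ hA).1
  refine ⟨t, ht, fun a ha => ?_⟩
  simpa using hcov ha

theorem Ncov_le_card_of_cover (hδ : 0 < δ) {A : Set (E n)} (t : Finset (E n))
    (ht : ∀ a ∈ A, ∃ c ∈ t, dist a c ≤ δ) : Ncov δ A ≤ t.card := by
  have hsub : A ⊆ ⋃ x ∈ t, Metric.closedBall x δ := fun a ha => by simpa using ht a ha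
  have hA : Bornology.IsBounded A :=
    ((Bornology.isBounded_biUnion_finset t).2 fun _ _ => Metric.isBounded_closedBall).subset hsub
  exact (isLeast_Ncov hδ hA).2 ⟨t, rfl, hsub⟩

theorem Ncov_mono (hδ : 0 < δ) {A B : Set (E n)} (hB : Bornology.IsBounded B) (h : A ⊆ B) :
    Ncov δ A ≤ Ncov δ B := by
  obtain ⟨t, ht, hc⟩ := exists_finset_cover hδ hB
  exact ht ▸ Ncov_le_card_of_cover hδ t fun a ha => hc a (h ha)

/-- A ball of radius `δ` contains at most one point of a set whose points are more than `2 * δ`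
apart, so for such sets `Ncov` just counts points and becomes additive. -/
theorem Ncov_eq_card (hδ : 0 < δ) {s : Finset (E n)}
    (hs : (s : Set (E n)).Pairwise fun x y => 2 * δ < dist x y) : Ncov δ (s : Set (E n)) = s.card := by
  apply le_antisymm
  · exact Ncov_le_card_of_cover hδ s fun a ha => ⟨a, ha, by simpa using hδ.le⟩
  · obtain ⟨t, ht, hc⟩ := exists_finset_cover hδ s.finite_toSet.isBounded
    rw [← ht]
    choose! f hf hd using hc
    refine Finset.card_le_card_of_injOn f (fun a ha => hf a ha) fun a ha b hb hab => ?_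
    by_contra hne
    have h1 := hs ha hb hne
    have h2 := hd a ha
    have h3 := hd b hb
    rw [← hab] at h3
    linarith [dist_triangle_right a b (f a)]

/-- Volume bound for a separated set in a ball: the balls of radius `d / 2` around its points are
disjoint. -/
theorem card_le_of_separated (s : Finset (E n)) {d R : ℝ} (hd : 0 < d) (hR : 0 ≤ R) (x : E n)
    (hs : ∀ a ∈ s, dist a x ≤ R) (hsep : (s : Set (E n)).Pairwise fun a b => d < dist a b) :
    (s.card : ℝ) ≤ (1 + 2 * R / d) ^ n := by
  have hd2 : 0 < d / 2 := by positivity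
  have hρ : 0 < R + d / 2 := by positivity
  have hdisj : (s : Set (E n)).PairwiseDisjoint fun c => Metric.ball c (d / 2) := by
    intro a ha b hb hab
    apply Metric.ball_disjoint_ball
    linarith [hsep ha hb hab]
  have hsub : (⋃ c ∈ s, Metric.ball c (d / 2)) ⊆ Metric.ball x (R + d / 2) := by
    refine Set.iUnion₂_subset fun a ha => Metric.ball_subset_ball' ?_
    linarith [hs a ha]
  have hvol : ∀ (c : E n) {r : ℝ}, 0 < r →
      volume (Metric.ball c r) = ENNReal.ofReal (r ^ n) * volume (Metric.ball (0 : E n) 1) := by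
    intro c r hr
    rw [Measure.addHaar_ball_of_pos _ _ hr, finrank_euclideanSpace_fin]
  have I : (s.card : ENNReal) * ENNReal.ofReal ((d / 2) ^ n) * volume (Metric.ball (0 : E n) 1) ≤
      ENNReal.ofReal ((R + d / 2) ^ n) * volume (Metric.ball (0 : E n) 1) :=
    calc _ = volume (⋃ c ∈ s, Metric.ball c (d / 2)) := by
          rw [measure_biUnion_finset hdisj fun c _ => measurableSet_ball]
          simp only [hvol _ hd2, Finset.sum_const, nsmul_eq_mul, mul_assoc]
      _ ≤ volume (Metric.ball x (R + d / 2)) := measure_mono hsub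
      _ = _ := hvol _ hρ
  have J := (ENNReal.mul_le_mul_iff_left (Metric.measure_ball_pos _ _ zero_lt_one).ne'
    measure_ball_lt_top.ne).1 I
  have K : (s.card : ℝ) * (d / 2) ^ n ≤ (R + d / 2) ^ n := by
    have := ENNReal.toReal_le_of_le_ofReal (pow_nonneg hρ.le _) J
    rwa [ENNReal.toReal_mul, ENNReal.toReal_ofReal (by positivity), ENNReal.toReal_natCast] at this
  have e : 1 + 2 * R / d = (R + d / 2) / (d / 2) := by field_simp; ring
  rw [e, div_pow, le_div_iff₀ (by positivity)]
  exact K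

theorem exists_maximal_separated {A : Set (E n)} (hA : Bornology.IsBounded A) {r : ℝ} (hr : 0 < r) :
    ∃ s : Finset (E n), (s : Set (E n)) ⊆ A ∧ ((s : Set (E n)).Pairwise fun x y => r < dist x y) ∧
      ∀ a ∈ A, ∃ c ∈ s, dist a c ≤ r := by
  classical
  obtain ⟨R, hR0, hR⟩ := hA.subset_closedBall_lt 0 0
  -- Separated subsets of `A` have bounded cardinality; one of the largest cardinality is maximal.
  let P : ℕ → Prop := fun N => ∃ s : Finset (E n), s.card = N ∧ (s : Set (E n)) ⊆ A ∧
    ((s : Set (E n)).Pairwise fun x y => r < dist x y)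
  have hbd : ∀ N, P N → N ≤ ⌊(1 + 2 * R / r) ^ n⌋₊ := by
    rintro N ⟨s, rfl, hsA, hs⟩
    exact Nat.le_floor (card_le_of_separated s hr hR0.le 0 (fun a ha => hR (hsA ha)) hs)
  have h0 : P 0 := ⟨∅, by simp⟩
  obtain ⟨s, hcard, hsA, hs⟩ := Nat.findGreatest_spec (P := P)
    (Nat.zero_le ⌊(1 + 2 * R / r) ^ n⌋₊) h0
  refine ⟨s, hsA, hs, fun a ha => ?_⟩
  by_contra! hcon
  have hmem : a ∉ s := fun h => by have := hcon a h; simp at this; linarith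
  have : P (s.card + 1) := by
    refine ⟨insert a s, Finset.card_insert_of_notMem hmem, ?_, ?_⟩
    · simp [Set.insert_subset_iff, ha, hsA]
    · rw [Finset.coe_insert, Set.pairwise_insert]
      exact ⟨hs, fun b hb _ => ⟨hcon b hb, by rw [dist_comm]; exact hcon b hb⟩⟩
  have h2 := Nat.le_findGreatest (hbd _ this) this
  rw [← hcard] at h2
  exact absurd h2 (by simp)

theorem card_le_mul_of_fiber {ι β : Type*} [DecidableEq β] (F : Finset ι) (t : Finset β) (h : ι → β)
    (hmaps : ∀ a ∈ F, h a ∈ t) {K : ℝ} (hK : ∀ b ∈ t, ((F.filter fun a => h a = b).card : ℝ) ≤ K) :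
    (F.card : ℝ) ≤ K * t.card := by
  rw [Finset.card_eq_sum_card_fiberwise (f := h) (t := t) hmaps]
  push_cast
  calc _ ≤ ∑ b ∈ t, K := Finset.sum_le_sum hK
    _ = _ := by rw [Finset.sum_const, nsmul_eq_mul, mul_comm]

theorem card_le_of_separated_of_diam (s : Finset (E n)) {d R : ℝ} (hd : 0 < d) (hR : 0 ≤ R)
    (hs : ∀ a ∈ s, ∀ b ∈ s, dist a b ≤ R)
    (hsep : (s : Set (E n)).Pairwise fun a b => d < dist a b) :
    (s.card : ℝ) ≤ (1 + 2 * R / d) ^ n := by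
  rcases s.eq_empty_or_nonempty with rfl | ⟨x, hx⟩
  · simp; positivity
  · exact card_le_of_separated s hd hR x (fun a ha => hs a ha x hx) hsep

/-- If points with `2 * δ`-close images under `f` have `R`-close images under `g`, then `g '' F` needs
at most a constant multiple of the number of balls that `f '' F` needs. -/
theorem Ncov_image_le (hδ : 0 < δ) {R : ℝ} (hR : 0 ≤ R) (F : Finset (E n)) (f : E n → E k)
    (g : E n → E l)
    (h : ∀ a ∈ F, ∀ b ∈ F, dist (f a) (f b) ≤ 2 * δ → dist (g a) (g b) ≤ R) :
    (Ncov δ (g '' F) : ℝ) ≤ (1 + 2 * R / δ) ^ l * Ncov δ (f '' F) := by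
  classical
  obtain ⟨t, ht, hc⟩ := exists_finset_cover hδ (F.finite_toSet.image f).isBounded
  obtain ⟨s, hsA, hs, hsc⟩ := exists_maximal_separated (F.finite_toSet.image g).isBounded hδ
  have h1 := Ncov_le_card_of_cover hδ s hsc
  have hpre : ∀ x ∈ s, ∃ a ∈ F, g a = x := fun x hx => hsA hx
  choose! p hpF hp using hpre
  have hcen : ∀ x ∈ s, ∃ c ∈ t, dist (f (p x)) c ≤ δ := fun x hx =>
    hc _ ⟨p x, hpF x hx, rfl⟩
  choose! c hct hcd using hcen
  rw [← ht]
  refine le_trans (by exact_mod_cast h1) (card_le_mul_of_fiber s t c hct fun b _ => ?_)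
  refine card_le_of_separated_of_diam _ hδ hR ?_ (hs.mono (Finset.filter_subset _ _))
  intro x hx y hy
  rw [Finset.mem_filter] at hx hy
  rw [← hp x hx.1, ← hp y hy.1]
  refine h _ (hpF x hx.1) _ (hpF y hy.1) ?_
  have e1 := hcd x hx.1
  have e2 := hcd y hy.1
  rw [hx.2] at e1
  rw [hy.2] at e2
  linarith [dist_triangle_right (f (p x)) (f (p y)) b]

/-- If points are close as soon as all their projections are, a separated set has at most as many
points as the grid spanned by its projections, up to a constant. -/
theorem card_le_prod_Ncov {q : ℕ} (hδ : 0 < δ) {R : ℝ} (hR : 0 ≤ R) (F : Finset (E n))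
    (hF : (F : Set (E n)).Pairwise fun a b => δ < dist a b) (f : Fin q → E n → E k)
    (h : ∀ a ∈ F, ∀ b ∈ F, (∀ i, dist (f i a) (f i b) ≤ 2 * δ) → dist a b ≤ R) :
    (F.card : ℝ) ≤ (1 + 2 * R / δ) ^ n * ∏ i, (Ncov δ (f i '' F) : ℝ) := by
  classical
  have hex : ∀ i, ∃ t : Finset (E k), t.card = Ncov δ (f i '' F) ∧
      ∀ a ∈ F, ∃ c ∈ t, dist (f i a) c ≤ δ := by
    intro i
    obtain ⟨t, ht, hc⟩ := exists_finset_cover hδ (F.finite_toSet.image (f i)).isBounded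
    exact ⟨t, ht, fun a ha => hc _ ⟨a, ha, rfl⟩⟩
  choose t ht hc using hex
  choose! c hct hcd using hc
  have key := card_le_mul_of_fiber F (Fintype.piFinset t) (fun a i => c i a)
    (fun a ha => Fintype.mem_piFinset.2 fun i => hct i a ha) (K := (1 + 2 * R / δ) ^ n) ?_
  · rw [Fintype.card_piFinset] at key
    push_cast at key
    simpa only [ht] using key
  · intro b _
    refine card_le_of_separated_of_diam _ hδ hR ?_ (hF.mono (Finset.filter_subset _ _))
    intro x hx y hy
    rw [Finset.mem_filter] at hx hy
    refine h x hx.1 y hy.1 fun i => ?_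
    have e1 := hcd i x hx.1
    have e2 := hcd i y hy.1
    rw [show c i x = b i from congrFun hx.2 i] at e1
    rw [show c i y = b i from congrFun hy.2 i] at e2
    linarith [dist_triangle_right (f i x) (f i y) (b i)]

/-- The distance `4 * δ` (instead of `2 * δ`) keeps the points more than `2 * δ` apart after projecting a
slice to the orthogonal complement of its direction. -/
theorem exists_separated_subset (hδ : 0 < δ) {A : Set (E n)} (hA : Bornology.IsBounded A) :
    ∃ s : Finset (E n), (s : Set (E n)) ⊆ A ∧
      ((s : Set (E n)).Pairwise fun x y => 4 * δ < dist x y) ∧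
      (Ncov δ A : ℝ) ≤ 17 ^ n * s.card := by
  classical
  obtain ⟨s₁, h₁A, h₁, hc₁⟩ := exists_maximal_separated hA hδ
  obtain ⟨s, hs₁, hs, hc⟩ := exists_maximal_separated s₁.finite_toSet.isBounded
    (by positivity : 0 < 4 * δ)
  refine ⟨s, hs₁.trans h₁A, hs, ?_⟩
  choose! c hcs hcd using hc
  refine le_trans (by exact_mod_cast Ncov_le_card_of_cover hδ s₁ hc₁)
    (card_le_mul_of_fiber s₁ s c hcs fun b _ => ?_)
  have := card_le_of_separated_of_diam (s₁.filter fun a => c a = b) hδ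
    (by positivity : 0 ≤ 8 * δ) ?_ (h₁.mono (Finset.filter_subset _ _))
  · refine this.trans (le_of_eq ?_)
    congr 1
    field_simp
    norm_num
  · intro x hx y hy
    rw [Finset.mem_filter] at hx hy
    have e1 := hcd x hx.1
    have e2 := hcd y hy.1
    rw [hx.2] at e1
    rw [hy.2] at e2
    linarith [dist_triangle_right x y b]

/-! ### The angle between complementary subspaces -/

theorem dang_nonneg (h : m + k = n) (V : Gr n m) (W : Gr n k) : 0 ≤ dang h V W := abs_nonneg _

/-- Hadamard's inequality. -/
theorem abs_det_le_prod_norm (f : Fin n → E n) :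
    |(EuclideanSpace.basisFun (Fin n) ℝ).toBasis.det f| ≤ ∏ i, ‖f i‖ := by
  have : Fact (Module.finrank ℝ (E n) = n) := ⟨finrank_euclideanSpace_fin⟩
  let o : Orientation ℝ (E n) (Fin n) := (EuclideanSpace.basisFun (Fin n) ℝ).toBasis.orientation
  rw [← o.volumeForm_robust' (EuclideanSpace.basisFun (Fin n) ℝ)]
  exact o.abs_volumeForm_apply_le f

/-- The sine of the angle between a vector of `V` and the subspace `W` is at least `d_∡(V, W)`. -/
theorem dang_mul_norm_le (h : m + k = n) (V : Gr n m) (W : Gr n k) {v w : E n} (hv : v ∈ V.1)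
    (hw : w ∈ W.1) : dang h V W * ‖v‖ ≤ ‖v + w‖ := by
  subst h
  rcases eq_or_ne v 0 with rfl | hv0
  · simp
  have hm : 0 < m := by
    rw [← V.2]
    exact Module.finrank_pos_iff_exists_ne_zero.2 ⟨⟨v, hv⟩, by simpa using hv0⟩
  have hnv : 0 < ‖v‖ := norm_pos_iff.2 hv0
  -- an orthonormal basis of `V` whose first vector is `v / ‖v‖`
  let x : V.1 := ⟨(‖v‖)⁻¹ • v, V.1.smul_mem _ hv⟩
  have hx : ‖x‖ = 1 := by
    change ‖(‖v‖)⁻¹ • v‖ = 1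
    rw [norm_smul, norm_inv, norm_norm, inv_mul_cancel₀ hnv.ne']
  let i₀ : Fin m := ⟨0, hm⟩
  obtain ⟨b, hb⟩ := Orthonormal.exists_orthonormalBasis_extension_of_card_eq (ι := Fin m)
    (𝕜 := ℝ) (E := V.1) (by rw [V.2, Fintype.card_fin]) (v := fun _ => x) (s := {i₀})
    (by
      rw [orthonormal_iff_ite]
      rintro ⟨i, rfl⟩ ⟨j, rfl⟩
      simp [hx])
  have hb0 : (b i₀ : E (m + k)) = (‖v‖)⁻¹ • v := congrArg Subtype.val (hb i₀ rfl)
  rw [dang_eq rfl V W b W.onb]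
  set f : Fin (m + k) → E (m + k) :=
    concat rfl (fun i => (b i : E (m + k))) (fun j => (W.onb j : E (m + k))) with hf
  set D := (EuclideanSpace.basisFun (Fin (m + k)) ℝ).toBasis.det
  have hfl : ∀ i, f (Fin.castAdd k i) = b i := fun i => by simp [hf, concat]
  have hfr : ∀ j, f (Fin.natAdd m j) = W.onb j := fun j => by simp [hf, concat]
  let I : Fin (m + k) := Fin.castAdd k i₀
  have hw' : (‖v‖)⁻¹ • w = ∑ j, (W.onb.repr ⟨w, hw⟩ j * (‖v‖)⁻¹) • f (Fin.natAdd m j) := by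
    have := congrArg (fun z : W.1 => (‖v‖)⁻¹ • (z : E (m + k))) (W.onb.sum_repr ⟨w, hw⟩)
    simp only [Submodule.coe_sum, Submodule.coe_smul, Finset.smul_sum] at this
    rw [← this]
    refine Finset.sum_congr rfl fun j _ => ?_
    rw [hfr, smul_smul, mul_comm]
  have hD : D f = D (Function.update f I ((‖v‖)⁻¹ • (v + w))) := by
    rw [smul_add, AlternatingMap.map_update_add, ← hb0, ← hfl, Function.update_eq_self, hw',
      AlternatingMap.map_update_sum, Finset.sum_eq_zero, add_zero]
    intro j _
    rw [AlternatingMap.map_update_smul, AlternatingMap.map_update_self, smul_zero]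
    intro e
    have := congrArg Fin.val e
    simp [I, i₀] at this
    omega
  have hle : |D f| ≤ ‖(‖v‖)⁻¹ • (v + w)‖ := by
    rw [hD]
    refine (abs_det_le_prod_norm _).trans ?_
    rw [← Finset.mul_prod_erase _ _ (Finset.mem_univ I), Function.update_self]
    refine mul_le_of_le_one_right (norm_nonneg _) (Finset.prod_le_one (fun _ _ => norm_nonneg _) ?_)
    intro i hi
    rw [Function.update_of_ne (Finset.ne_of_mem_erase hi)]
    refine Fin.addCases (fun i => ?_) (fun j => ?_) i
    · rw [hfl]; exact (b.norm_eq_one i).le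
    · rw [hfr]; exact (W.onb.norm_eq_one j).le
  rw [norm_smul, norm_inv, norm_norm, ← div_eq_inv_mul, le_div_iff₀ hnv] at hle
  exact hle

theorem sup_eq_top_of_dang_pos (h : m + k = n) (V : Gr n m) (W : Gr n k) (hd : 0 < dang h V W) :
    V.1 ⊔ W.1 = ⊤ := by
  have hinf : V.1 ⊓ W.1 = ⊥ := by
    rw [eq_bot_iff]
    intro v hv
    have h1 := dang_mul_norm_le h V W hv.1 (W.1.neg_mem hv.2)
    rw [add_neg_cancel, norm_zero] at h1
    have h2 : ‖v‖ ≤ 0 := by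
      by_contra hcon
      have := mul_pos hd (not_le.1 hcon)
      linarith
    simpa using h2
  apply Submodule.eq_top_of_finrank_eq
  have := Submodule.finrank_sup_add_finrank_inf_eq V.1 W.1
  rw [hinf, finrank_bot, add_zero, V.2, W.2, h] at this
  rw [this, finrank_euclideanSpace_fin]

/-- The dual form of `dang_mul_norm_le`: a vector orthogonal to `W` is not nearly orthogonal to
`V`. -/
theorem dang_mul_norm_le_proj (h : m + k = n) (V : Gr n m) (W : Gr n k) {u : E n}
    (hu : ∀ w ∈ W.1, ⟪u, w⟫_ℝ = 0) : dang h V W * ‖u‖ ≤ ‖V.proj u‖ := by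
  rcases (dang_nonneg h V W).eq_or_lt with h0 | hd
  · rw [← h0, zero_mul]; exact norm_nonneg _
  have hmem : u ∈ V.1 ⊔ W.1 := by rw [sup_eq_top_of_dang_pos h V W hd]; trivial
  obtain ⟨v, hv, w, hw, rfl⟩ := Submodule.mem_sup.1 hmem
  have h1 := dang_mul_norm_le h V W hv hw
  set u := v + w
  have h2 : ‖u‖ ^ 2 = ⟪V.proj u, v⟫_ℝ := by
    have e1 : ⟪V.proj u, v⟫_ℝ = ⟪u, v⟫_ℝ := by
      rw [Gr.proj, Submodule.inner_starProjection_left_eq_right,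
        Submodule.starProjection_eq_self_iff.2 hv]
    have e2 : ⟪u, u⟫_ℝ = ⟪u, v⟫_ℝ + ⟪u, w⟫_ℝ := inner_add_right _ _ _
    rw [e1, ← real_inner_self_eq_norm_sq, e2, hu w hw, add_zero]
  have h3 := real_inner_le_norm (V.proj u) v
  rcases eq_or_ne ‖u‖ 0 with hu0 | hu0
  · rw [hu0, mul_zero]; exact norm_nonneg _
  have hu1 : 0 < ‖u‖ := lt_of_le_of_ne (norm_nonneg _) (Ne.symm hu0)
  have h4 : dang h V W * ‖u‖ ^ 2 ≤ ‖V.proj u‖ * ‖u‖ :=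
    calc _ ≤ dang h V W * (‖V.proj u‖ * ‖v‖) := by rw [h2]; gcongr
      _ = ‖V.proj u‖ * (dang h V W * ‖v‖) := by ring
      _ ≤ _ := by gcongr
  rw [pow_two, ← mul_assoc] at h4
  exact le_of_mul_le_mul_right h4 hu1

theorem exists_superspace (F : Submodule ℝ (E n)) (hF : Module.finrank ℝ F ≤ k) (hk : k ≤ n) :
    ∃ W : Gr n k, F ≤ W.1 := by
  obtain ⟨j, rfl⟩ := Nat.exists_eq_add_of_le hF
  induction j generalizing F with
  | zero => exact ⟨⟨F, rfl⟩, le_rfl⟩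
  | succ j ih =>
    have hne : F ≠ ⊤ := by
      rintro rfl
      rw [finrank_top, finrank_euclideanSpace_fin] at hk
      omega
    obtain ⟨x, -, hx⟩ := SetLike.exists_of_lt (lt_top_iff_ne_top.2 hne)
    have hx0 : x ≠ 0 := by rintro rfl; exact hx F.zero_mem
    have hdim : Module.finrank ℝ ↥(F ⊔ Submodule.span ℝ {x}) = Module.finrank ℝ F + 1 := by
      have := Submodule.finrank_sup_add_finrank_inf_eq F (Submodule.span ℝ {x})
      rw [finrank_span_singleton hx0, disjoint_iff.1 ((Submodule.disjoint_span_singleton' hx0).2 hx),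
        finrank_bot, add_zero] at this
      exact this
    have heq : Module.finrank ℝ F + (j + 1) =
      Module.finrank ℝ ↥(F ⊔ Submodule.span ℝ {x}) + j := by rw [hdim]; ring
    rw [heq] at hF hk ⊢
    obtain ⟨W, hW⟩ := ih _ (by omega) hk
    exact ⟨W, le_sup_left.trans hW⟩

theorem exists_orthogonal_subspace (h : m + k = n) (hm : 0 < m) (u : E n) :
    ∃ W : Gr n k, ∀ w ∈ W.1, ⟪u, w⟫_ℝ = 0 := by
  obtain ⟨Z, hZ⟩ := exists_superspace (k := m) (Submodule.span ℝ {u})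
    ((finrank_span_le_card _).trans (by simpa using Nat.succ_le_of_lt hm)) (by omega)
  refine ⟨⟨Z.1ᗮ, ?_⟩, fun w hw => hw u (hZ (Submodule.mem_span_singleton_self u))⟩
  have := Submodule.finrank_add_finrank_orthogonal Z.1
  rw [Z.2, finrank_euclideanSpace_fin] at this
  omega

/-- `d_∡(V, W)²` is the determinant of the Gram matrix of an orthonormal basis of `V` followed by an
orthonormal basis of `W`. -/
theorem dang_sq_eq_gram (h : m + k = n) (V : Gr n m) (W : Gr n k)
    (v : OrthonormalBasis (Fin m) ℝ V.1) (w : OrthonormalBasis (Fin k) ℝ W.1) :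
    dang h V W ^ 2 = (Matrix.fromBlocks 1 (Matrix.of fun i j => ⟪(v i : E n), (w j : E n)⟫_ℝ)
      (Matrix.of fun j i => ⟪(w j : E n), (v i : E n)⟫_ℝ) 1).det := by
  subst h
  rw [dang_eq rfl V W v w, sq_abs, pow_two, Module.Basis.det_apply]
  set f : Fin (m + k) → E (m + k) :=
    concat rfl (fun i => (v i : E (m + k))) (fun j => (w j : E (m + k))) with hf
  have hfl : ∀ i, f (Fin.castAdd k i) = v i := fun i => by simp [hf, concat]
  have hfr : ∀ j, f (Fin.natAdd m j) = w j := fun j => by simp [hf, concat]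
  set M := (EuclideanSpace.basisFun (Fin (m + k)) ℝ).toBasis.toMatrix f with hM
  nth_rewrite 1 [← Matrix.det_transpose]
  rw [← Matrix.det_mul, ← Matrix.det_submatrix_equiv_self finSumFinEquiv]
  have hMM : ∀ i j, (M.transpose * M) i j = ⟪f i, f j⟫_ℝ := by
    intro i j
    rw [Matrix.mul_apply, PiLp.inner_apply]
    refine Finset.sum_congr rfl fun c _ => ?_
    simp [hM, Module.Basis.toMatrix_apply, mul_comm]
  congr 1
  ext i j
  rw [Matrix.submatrix_apply, hMM]
  rcases i with i | i <;> rcases j with j | j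
  · have := orthonormal_iff_ite.1 v.orthonormal i j
    simp [hfl, Matrix.one_apply]
    simpa using this
  · simp [hfl, hfr]
  · simp [hfl, hfr]
  · have := orthonormal_iff_ite.1 w.orthonormal i j
    simp [hfr, Matrix.one_apply]
    simpa using this

theorem inner_starProjection_eq_sum {U : Submodule ℝ (E n)} (u : OrthonormalBasis (Fin k) ℝ U)
    (x y : E n) :
    ⟪x, U.starProjection y⟫_ℝ = ∑ j, ⟪x, (u j : E n)⟫_ℝ * ⟪(u j : E n), y⟫_ℝ := by
  rw [u.starProjection_eq_sum_rankOne, sum_apply, inner_sum]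
  refine Finset.sum_congr rfl fun j _ => ?_
  rw [InnerProductSpace.rankOne_apply, real_inner_smul_right, mul_comm]

theorem dang_sq_eq_det (h : m + k = n) (V : Gr n m) (W : Gr n k)
    (v : OrthonormalBasis (Fin m) ℝ V.1) :
    dang h V W ^ 2 =
      (Matrix.of fun i j => ⟪(v i : E n), (v j : E n) - W.proj (v j)⟫_ℝ).det := by
  rw [dang_sq_eq_gram h V W v W.onb, Matrix.det_fromBlocks_one₂₂]
  congr 1
  ext i j
  have := orthonormal_iff_ite.1 v.orthonormal i j
  rw [Submodule.coe_inner] at this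
  simp only [Matrix.sub_apply, Matrix.mul_apply, Matrix.of_apply, inner_sub_right, Gr.proj,
    inner_starProjection_eq_sum W.onb, this, Matrix.one_apply]

theorem dang_sq_eq_det' (h : m + k = n) (V : Gr n m) (W : Gr n k)
    (w : OrthonormalBasis (Fin k) ℝ W.1) :
    dang h V W ^ 2 =
      (Matrix.of fun i j => ⟪(w i : E n), (w j : E n) - V.proj (w j)⟫_ℝ).det := by
  rw [dang_sq_eq_gram h V W V.onb w, Matrix.det_fromBlocks_one₁₁]
  congr 1
  ext i j
  have := orthonormal_iff_ite.1 w.orthonormal i j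
  rw [Submodule.coe_inner] at this
  simp only [Matrix.sub_apply, Matrix.mul_apply, Matrix.of_apply, inner_sub_right, Gr.proj,
    inner_starProjection_eq_sum V.onb, this, Matrix.one_apply]

theorem Gr.continuous_proj : Continuous (Gr.proj : Gr n m → E n →L[ℝ] E n) :=
  continuous_induced_dom

theorem isClosed_Vang (h : m + k = n) (W : Gr n k) (ρ : ℝ) : IsClosed (Vang h W ρ) := by
  have hc : Continuous fun V : Gr n m => dang h V W := by
    have : (fun V : Gr n m => dang h V W) = fun V => √((Matrix.of fun i j =>
        ⟪(W.onb i : E n), (W.onb j : E n) - V.proj (W.onb j)⟫_ℝ).det) := by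
      ext V
      rw [← dang_sq_eq_det' h V W W.onb, Real.sqrt_sq (dang_nonneg h V W)]
    rw [this]
    refine Real.continuous_sqrt.comp (Continuous.matrix_det ?_)
    refine continuous_matrix fun i j => ?_
    exact continuous_const.inner (continuous_const.sub (Gr.continuous_proj.clm_apply continuous_const))
  exact isClosed_le hc continuous_const

/-! ### Transfer of directions to a slice -/

/-- The image of `V` under the linear map `T`, when `T` is injective on `V`; an arbitrary subspace
otherwise. -/
noncomputable def Gr.push (hml : m ≤ l) (T : E n →L[ℝ] E l) (V : Gr n m) : Gr l m :=
  open Classical in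
  if h : Module.finrank ℝ (V.1.map (T : E n →ₗ[ℝ] E l)) = m then ⟨_, h⟩
  else (exists_superspace ⊥ (by simp) hml).choose

theorem Gr.push_val (hml : m ≤ l) (T : E n →L[ℝ] E l) (V : Gr n m)
    (h : Module.finrank ℝ (V.1.map (T : E n →ₗ[ℝ] E l)) = m) :
    (Gr.push hml T V).1 = V.1.map (T : E n →ₗ[ℝ] E l) := by
  have : Gr.push hml T V = ⟨_, h⟩ := dif_pos h
  rw [this]

/-- The orthogonal projection onto the range of an injective map `S` is `S (S* S)⁻¹ S*`. -/
theorem starProjection_eq_of_range {S : E m →L[ℝ] E l} {K : Submodule ℝ (E l)}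
    (hK : LinearMap.range (S : E m →ₗ[ℝ] E l) = K) (hu : IsUnit (S.adjoint ∘L S)) :
    K.starProjection = S ∘L Ring.inverse (S.adjoint ∘L S) ∘L S.adjoint := by
  ext1 x
  refine Submodule.eq_starProjection_of_mem_of_inner_eq_zero ?_ ?_
  · rw [← hK]
    exact ⟨_, rfl⟩
  · rw [← hK]
    rintro _ ⟨y, rfl⟩
    have h1 : (S.adjoint ∘L S) * Ring.inverse (S.adjoint ∘L S) = 1 := Ring.mul_inverse_cancel _ hu
    have h2 := DFunLike.congr_fun h1 (S.adjoint x)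
    simp only [mul_apply_eq_comp, ContinuousLinearMap.comp_apply,
      one_apply_eq_self] at h2
    simp only [ContinuousLinearMap.coe_coe, ContinuousLinearMap.comp_apply]
    rw [← ContinuousLinearMap.adjoint_inner_left, map_sub, h2, sub_self, inner_zero_left]

theorem isUnit_adjoint_comp_self {S : E m →L[ℝ] E l} (hS : Function.Injective S) :
    IsUnit (S.adjoint ∘L S) := by
  rw [ContinuousLinearMap.isUnit_iff_bijective]
  have hinj : Function.Injective (S.adjoint ∘L S) := by
    rw [injective_iff_map_eq_zero]
    intro x hx
    have : ⟪S x, S x⟫_ℝ = 0 := by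
      rw [← ContinuousLinearMap.adjoint_inner_left]
      rw [ContinuousLinearMap.comp_apply] at hx
      rw [hx, inner_zero_left]
    rw [inner_self_eq_zero] at this
    exact (injective_iff_map_eq_zero S).1 hS x this
  exact ⟨hinj, LinearMap.surjective_of_injective
    (f := ((S.adjoint ∘L S : E m →L[ℝ] E m) : E m →ₗ[ℝ] E m)) hinj⟩

/-- If `T` is injective on `V₀`, a basis of `T V₀` extends to vectors of `T V` depending continuously on
`V` (the columns of `S V`), which form a basis of `T V` as long as their Gram matrix is
invertible, hence near `V₀`. -/
theorem Gr.exists_continuous_frame (T : E n →L[ℝ] E l) (V₀ : Gr n m)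
    (h₀ : Module.finrank ℝ (V₀.1.map (T : E n →ₗ[ℝ] E l)) = m) :
    ∃ S : Gr n m → E m →L[ℝ] E l, Continuous S ∧ IsUnit ((S V₀).adjoint ∘L S V₀) ∧
      ∀ V, IsUnit ((S V).adjoint ∘L S V) →
        LinearMap.range (S V : E m →ₗ[ℝ] E l) = V.1.map (T : E n →ₗ[ℝ] E l) ∧
        Module.finrank ℝ (V.1.map (T : E n →ₗ[ℝ] E l)) = m := by
  let ι : E m →L[ℝ] E n := V₀.1.subtypeL ∘L (V₀.onb.repr.symm : E m →L[ℝ] V₀.1)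
  have hι : ∀ x, ι x ∈ V₀.1 := fun x => (V₀.onb.repr.symm x).2
  have hcomp : ∀ x, V₀.proj (ι x) = ι x := fun x => Submodule.starProjection_eq_self_iff.2 (hι x)
  let S : Gr n m → E m →L[ℝ] E l := fun V => T ∘L V.proj ∘L ι
  have hTinj : ∀ v ∈ V₀.1, T v = 0 → v = 0 := by
    have hdim := LinearMap.finrank_range_add_finrank_ker
      ((T : E n →ₗ[ℝ] E l).domRestrict V₀.1)
    rw [LinearMap.range_domRestrict, h₀, V₀.2] at hdim
    have hker : LinearMap.ker ((T : E n →ₗ[ℝ] E l).domRestrict V₀.1) = ⊥ :=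
      Submodule.finrank_eq_zero.1 (by omega)
    intro v hv hTv
    have : (⟨v, hv⟩ : V₀.1) ∈ LinearMap.ker ((T : E n →ₗ[ℝ] E l).domRestrict V₀.1) := hTv
    rw [hker, Submodule.mem_bot] at this
    exact congrArg Subtype.val this
  refine ⟨S, ?_, isUnit_adjoint_comp_self ?_, fun V hV => ?_⟩
  · exact continuous_const.clm_comp (Gr.continuous_proj.clm_comp continuous_const)
  · rw [injective_iff_map_eq_zero]
    intro x hx
    have h1 : ι x = 0 := by
      apply hTinj _ (hι x)
      have : T (V₀.proj (ι x)) = 0 := hx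
      rwa [hcomp] at this
    have h2 : V₀.onb.repr.symm x = 0 := Subtype.ext h1
    simpa using h2
  · have hinj : Function.Injective (S V : E m →ₗ[ℝ] E l) := by
      have := ((ContinuousLinearMap.isUnit_iff_bijective).1 hV).1
      exact Function.Injective.of_comp (f := (S V).adjoint) this
    have hrank := LinearMap.finrank_range_of_inj hinj
    rw [finrank_euclideanSpace_fin] at hrank
    have hle : LinearMap.range (S V : E m →ₗ[ℝ] E l) ≤ V.1.map (T : E n →ₗ[ℝ] E l) := by
      rintro _ ⟨x, rfl⟩
      exact ⟨V.proj (ι x), Submodule.starProjection_apply_mem _ _, rfl⟩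
    have hle2 : Module.finrank ℝ (V.1.map (T : E n →ₗ[ℝ] E l)) ≤ m := by
      conv_rhs => rw [← V.2]
      exact Submodule.finrank_map_le _ _
    have heq := Submodule.eq_of_le_of_finrank_le hle (by rw [hrank]; exact hle2)
    exact ⟨heq, heq ▸ hrank⟩

theorem Gr.measurable_push (hml : m ≤ l) (T : E n →L[ℝ] E l) :
    Measurable (Gr.push hml T : Gr n m → Gr l m) := by
  let O : Set (Gr n m) := {V | Module.finrank ℝ (V.1.map (T : E n →ₗ[ℝ] E l)) = m}
  have hO : IsOpen O := by
    rw [isOpen_iff_mem_nhds]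
    intro V₀ h₀
    obtain ⟨S, hS, hu, hV⟩ := Gr.exists_continuous_frame T V₀ h₀
    have hc : Continuous fun V => (S V).adjoint ∘L S V :=
      (ContinuousLinearMap.adjoint.continuous.comp hS).clm_comp hS
    filter_upwards [hc.continuousAt.preimage_mem_nhds (Units.isOpen.mem_nhds hu)] with V h1
    exact (hV V h1).2
  have hcont : ∀ V₀ ∈ O, ContinuousAt (Gr.push hml T) V₀ := by
    intro V₀ h₀
    obtain ⟨S, hS, hu, hV⟩ := Gr.exists_continuous_frame T V₀ h₀
    have hc' : Continuous fun V => (S V).adjoint := ContinuousLinearMap.adjoint.continuous.comp hS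
    have hc : Continuous fun V => (S V).adjoint ∘L S V := hc'.clm_comp hS
    have hind : nhds (Gr.push hml T V₀) = Filter.comap Gr.proj (nhds (Gr.push hml T V₀).proj) :=
      nhds_induced _ _
    rw [ContinuousAt, hind, Filter.tendsto_comap_iff]
    have hev : (fun V => S V ∘L Ring.inverse ((S V).adjoint ∘L S V) ∘L (S V).adjoint) =ᶠ[nhds V₀]
        Gr.proj ∘ Gr.push hml T := by
      filter_upwards [hc.continuousAt.preimage_mem_nhds (Units.isOpen.mem_nhds hu)] with V h1
      rw [Function.comp_apply, Gr.proj, starProjection_eq_of_range _ h1]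
      rw [Gr.push_val _ _ _ (hV V h1).2, (hV V h1).1]
    have hinv : ContinuousAt (fun V => Ring.inverse ((S V).adjoint ∘L S V)) V₀ := by
      obtain ⟨u, hu'⟩ := hu
      have := NormedRing.inverse_continuousAt u
      rw [hu'] at this
      exact ContinuousAt.comp (f := fun V => (S V).adjoint ∘L S V) this hc.continuousAt
    have : ContinuousAt
        (fun V => S V ∘L Ring.inverse ((S V).adjoint ∘L S V) ∘L (S V).adjoint) V₀ :=
      hS.continuousAt.clm_comp (hinv.clm_comp hc'.continuousAt)
    exact (this.congr hev).tendsto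
  refine measurable_of_restrict_of_restrict_compl hO.measurableSet ?_ ?_
  · refine Continuous.measurable (continuous_iff_continuousAt.2 fun V => ?_)
    exact (hcont V.1 V.2).comp continuous_subtype_val.continuousAt
  · have : Oᶜ.domRestrict (Gr.push hml T) =
        fun _ => (exists_superspace ⊥ (by simp) hml).choose := funext fun V => dif_neg V.2
    rw [this]
    exact measurable_const

theorem inner_adjoint_left (J : E l →ₗᵢ[ℝ] E n) (x : E n) (y : E l) :
    ⟪J.toContinuousLinearMap.adjoint x, y⟫_ℝ = ⟪x, J y⟫_ℝ :=
  ContinuousLinearMap.adjoint_inner_left _ _ _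

/-- `J` is an isometric parametrisation of the orthogonal complement of `U`. -/
def Parametrizes (J : E l →ₗᵢ[ℝ] E n) (U : Gr n m) : Prop :=
  ∀ x, J (J.toContinuousLinearMap.adjoint x) = x - U.proj x

theorem exists_parametrizes (h : m + l = n) (U : Gr n m) :
    ∃ J : E l →ₗᵢ[ℝ] E n, Parametrizes J U := by
  have hdim : Module.finrank ℝ U.1ᗮ = l := by
    have := Submodule.finrank_add_finrank_orthogonal U.1
    rw [U.2, finrank_euclideanSpace_fin] at this
    omega
  let b : OrthonormalBasis (Fin l) ℝ U.1ᗮ := (stdOrthonormalBasis ℝ U.1ᗮ).reindex (finCongr hdim)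
  let J : E l →ₗᵢ[ℝ] E n := U.1ᗮ.subtypeₗᵢ.comp b.repr.symm.toLinearIsometry
  refine ⟨J, fun x => ?_⟩
  have hJ : ∀ y, J y ∈ U.1ᗮ := fun y => (b.repr.symm y).2
  have hsurj : ∀ z ∈ U.1ᗮ, ∃ y, J y = z := fun z hz => ⟨b.repr ⟨z, hz⟩, by
    change ((b.repr.symm (b.repr ⟨z, hz⟩) : U.1ᗮ) : E n) = z
    rw [LinearIsometryEquiv.symm_apply_apply]⟩
  have key : U.1ᗮ.starProjection x = J (J.toContinuousLinearMap.adjoint x) := by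
    refine Submodule.eq_starProjection_of_mem_of_inner_eq_zero (hJ _) fun w hw => ?_
    obtain ⟨y, rfl⟩ := hsurj w hw
    rw [inner_sub_left, J.inner_map_map, ContinuousLinearMap.adjoint_inner_left]
    exact sub_self _
  rw [← key, Submodule.starProjection_orthogonal_val]
  rfl

section

variable {J : E l →ₗᵢ[ℝ] E n} {U : Gr n m}

theorem adjoint_apply_self (J : E l →ₗᵢ[ℝ] E n) (y : E l) :
    J.toContinuousLinearMap.adjoint (J y) = y := by
  refine ext_inner_right ℝ fun z => ?_
  rw [ContinuousLinearMap.adjoint_inner_left]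
  exact J.inner_map_map y z

theorem Parametrizes.proj_eq_zero (hJ : Parametrizes J U) (y : E l) : U.proj (J y) = 0 := by
  have := hJ (J y)
  rw [adjoint_apply_self] at this
  exact sub_eq_self.1 this.symm

/-- A subspace making no small angle with `W ⊇ U` meets `U` trivially, so it has an image of full
dimension in the slice. -/
theorem finrank_map_of_dang_pos (hJ : Parametrizes J U) (h : m + k = n) {V : Gr n m} {W : Gr n k}
    (hUW : U.1 ≤ W.1) (hd : 0 < dang h V W) :
    Module.finrank ℝ (V.1.map
      (J.toContinuousLinearMap.adjoint : E n →ₗ[ℝ] E l)) = m := by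
  set T := J.toContinuousLinearMap.adjoint
  have hker : LinearMap.ker ((T : E n →ₗ[ℝ] E l).domRestrict V.1) = ⊥ := by
    rw [LinearMap.ker_eq_bot']
    rintro ⟨v, hv⟩ hTv
    have h1 : T v = 0 := hTv
    have h2 := hJ v
    rw [show J.toContinuousLinearMap.adjoint v = 0 from h1, map_zero] at h2
    have h3 := dang_mul_norm_le h V W hv
      (W.1.neg_mem (hUW (Submodule.starProjection_apply_mem U.1 v)))
    rw [← sub_eq_add_neg] at h3
    rw [show v - U.1.starProjection v = 0 from h2.symm, norm_zero] at h3
    have h4 : ‖v‖ ≤ 0 := by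
      by_contra hcon
      have := mul_pos hd (not_le.1 hcon)
      linarith
    exact Subtype.ext (by simpa using h4)
  have hdim := LinearMap.finrank_range_add_finrank_ker ((T : E n →ₗ[ℝ] E l).domRestrict V.1)
  rw [LinearMap.range_domRestrict, hker, finrank_bot, add_zero, V.2] at hdim
  exact hdim

/-- On the slice, the projection to `V` is as large, up to the angle of `V` and `W ⊇ U`, as the
projection to the image of `V`. -/
theorem dang_mul_norm_push_le (hJ : Parametrizes J U) (h : m + k = n) (hml : m ≤ l) {V : Gr n m}
    {W : Gr n k} (hUW : U.1 ≤ W.1) (y : E l) :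
    dang h V W * ‖(Gr.push hml J.toContinuousLinearMap.adjoint V).proj y‖ ≤ ‖V.proj (J y)‖ := by
  rcases (dang_nonneg h V W).eq_or_lt with h0 | hd
  · rw [← h0, zero_mul]; exact norm_nonneg _
  have hval := Gr.push_val hml _ V (finrank_map_of_dang_pos hJ h hUW hd)
  set T := J.toContinuousLinearMap.adjoint with hT
  set V' := Gr.push hml T V
  have hmem : V'.proj y ∈ V'.1 := Submodule.starProjection_apply_mem _ _
  rw [hval] at hmem
  obtain ⟨v, hv, hvp⟩ := hmem
  replace hvp : T v = V'.proj y := hvp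
  have h1 : ⟪V.proj (J y), v⟫_ℝ = ‖V'.proj y‖ ^ 2 := by
    have e1 : ⟪V.proj (J y), v⟫_ℝ = ⟪J y, v⟫_ℝ := by
      rw [Gr.proj, Submodule.inner_starProjection_left_eq_right,
        Submodule.starProjection_eq_self_iff.2 hv]
    have e2 : ⟪J y, v⟫_ℝ = ⟪y, T v⟫_ℝ := by
      rw [real_inner_comm, ← inner_adjoint_left, real_inner_comm]
    have e3 : ⟪V'.proj y, V'.proj y⟫_ℝ = ⟪y, V'.proj y⟫_ℝ := by
      rw [Gr.proj, Submodule.inner_starProjection_left_eq_right,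
        Submodule.starProjection_eq_self_iff.2 (Submodule.starProjection_apply_mem _ _)]
    rw [e1, e2, hvp, ← e3, real_inner_self_eq_norm_sq]
  have h2 : dang h V W * ‖v‖ ≤ ‖V'.proj y‖ := by
    have := dang_mul_norm_le h V W hv
      (W.1.neg_mem (hUW (Submodule.starProjection_apply_mem U.1 v)))
    rw [← sub_eq_add_neg] at this
    rwa [← hvp, ← J.norm_map, hJ v]
  have h3 := real_inner_le_norm (V.proj (J y)) v
  rw [h1] at h3
  rcases eq_or_ne ‖V'.proj y‖ 0 with hp0 | hp0
  · rw [hp0, mul_zero]; exact norm_nonneg _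
  have hp1 : 0 < ‖V'.proj y‖ := lt_of_le_of_ne (norm_nonneg _) (Ne.symm hp0)
  refine le_of_mul_le_mul_right ?_ hp1
  calc dang h V W * ‖V'.proj y‖ * ‖V'.proj y‖ = dang h V W * ‖V'.proj y‖ ^ 2 := by ring
    _ ≤ dang h V W * (‖V.proj (J y)‖ * ‖v‖) := by gcongr
    _ = ‖V.proj (J y)‖ * (dang h V W * ‖v‖) := by ring
    _ ≤ _ := by gcongr

/-- Small angles in the slice come from small angles in the ambient space. -/
theorem exists_preimage_Vang_subset (hJ : Parametrizes J U) (h : m + l = n) (h' : m + k = l)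
    (hml : m ≤ l) (W' : Gr l k) : ∃ W : Gr n l, ∀ ρ : ℝ, 0 ≤ ρ →
      Gr.push hml J.toContinuousLinearMap.adjoint ⁻¹' Vang h' W' ρ ⊆ Vang h W ρ := by
  set T := J.toContinuousLinearMap.adjoint with hT
  let Z : Submodule ℝ (E n) := W'.1ᗮ.map (J : E l →ₗ[ℝ] E n)
  have hZ : Module.finrank ℝ Z = m := by
    rw [show Module.finrank ℝ Z = Module.finrank ℝ W'.1ᗮ from
      (Submodule.equivMapOfInjective (J : E l →ₗ[ℝ] E n) J.injective W'.1ᗮ).finrank_eq.symm]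
    have := Submodule.finrank_add_finrank_orthogonal W'.1
    rw [W'.2, finrank_euclideanSpace_fin] at this
    omega
  have hW : Module.finrank ℝ Zᗮ = l := by
    have := Submodule.finrank_add_finrank_orthogonal Z
    rw [hZ, finrank_euclideanSpace_fin] at this
    omega
  let W : Gr n l := ⟨Zᗮ, hW⟩
  have hproj : ∀ x, x - W.proj x = J (T x - W'.proj (T x)) := by
    intro x
    have : Z.starProjection x = J (T x - W'.proj (T x)) := by
      refine Submodule.eq_starProjection_of_mem_of_inner_eq_zero
        ⟨_, Submodule.sub_starProjection_mem_orthogonal _, rfl⟩ ?_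
      rintro _ ⟨y, hy, rfl⟩
      change ⟪x - J (T x - W'.proj (T x)), J y⟫_ℝ = 0
      have e : ⟪x, J y⟫_ℝ = ⟪T x, y⟫_ℝ := (inner_adjoint_left J x y).symm
      rw [inner_sub_left, J.inner_map_map, e, ← inner_sub_left, sub_sub_cancel]
      exact hy _ (Submodule.starProjection_apply_mem _ _)
    rw [← this, Gr.proj, Submodule.starProjection_orthogonal_val, sub_sub_cancel]
  have hUW : U.1 ≤ W.1 := by
    rintro u hu _ ⟨y, hy, rfl⟩
    change ⟪J y, u⟫_ℝ = 0
    rw [← Submodule.starProjection_eq_self_iff.2 hu, ← Submodule.inner_starProjection_left_eq_right]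
    rw [show U.1.starProjection (J y) = 0 from hJ.proj_eq_zero y, inner_zero_left]
  refine ⟨W, fun ρ hρ V hV => ?_⟩
  change dang h V W ≤ ρ
  rcases (dang_nonneg h V W).eq_or_lt with h0 | hd
  · rw [← h0]; exact hρ
  have hval := Gr.push_val hml T V (finrank_map_of_dang_pos hJ h hUW hd)
  set V' := Gr.push hml T V with hV'
  refine le_trans ?_ (show dang h' V' W' ≤ ρ from hV)
  rw [← sq_le_sq₀ hd.le (dang_nonneg _ _ _)]
  have hmem : ∀ j, T (V.onb j) ∈ V'.1 := fun j => by
    rw [hval]; exact ⟨_, (V.onb j).2, rfl⟩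
  let f : Fin m → E m := fun j => V'.onb.repr ⟨_, hmem j⟩
  let R : Matrix (Fin m) (Fin m) ℝ := (EuclideanSpace.basisFun (Fin m) ℝ).toBasis.toMatrix f
  have hR : ∀ a j, R a j = V'.onb.repr ⟨_, hmem j⟩ a := fun a j => by
    simp [R, f, Module.Basis.toMatrix_apply]
  have hsum : ∀ j, T (V.onb j) = ∑ a, R a j • (V'.onb a : E l) := by
    intro j
    have := congrArg Subtype.val (V'.onb.sum_repr ⟨_, hmem j⟩)
    simp only [Submodule.coe_sum, Submodule.coe_smul] at this
    rw [← this]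
    exact Finset.sum_congr rfl fun a _ => by rw [hR]
  set G : Matrix (Fin m) (Fin m) ℝ :=
    Matrix.of fun i j => ⟪(V'.onb i : E l), (V'.onb j : E l) - W'.proj (V'.onb j)⟫_ℝ with hG
  have hdet : R.det ^ 2 ≤ 1 := by
    have h1 : |R.det| ≤ 1 := by
      refine (abs_det_le_prod_norm f).trans (Finset.prod_le_one (fun _ _ => norm_nonneg _) ?_)
      intro j _
      rw [LinearIsometryEquiv.norm_map]
      change ‖T (V.onb j)‖ ≤ 1
      rw [← J.norm_map, hJ]
      have h2 : ‖(V.onb j : E n) - U.proj (V.onb j)‖ ≤ ‖(V.onb j : E n)‖ := by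
        rw [Gr.proj, ← Submodule.starProjection_orthogonal_val]
        exact Submodule.norm_starProjection_apply_le _ _
      exact h2.trans (V.onb.norm_eq_one j).le
    rw [← sq_abs]
    exact pow_le_one₀ (abs_nonneg _) h1
  have hmat : (Matrix.of fun i j => ⟪(V.onb i : E n), (V.onb j : E n) - W.proj (V.onb j)⟫_ℝ) =
      R.transpose * G * R := by
    ext i j
    have e : ∀ x : E l, ⟪(V.onb i : E n), J x⟫_ℝ = ⟪T (V.onb i), x⟫_ℝ := fun x =>
      (inner_adjoint_left J _ x).symm
    rw [Matrix.of_apply, hproj, e, hsum i, hsum j, map_sum, ← Finset.sum_sub_distrib, sum_inner,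
      Matrix.mul_assoc, Matrix.mul_apply]
    refine Finset.sum_congr rfl fun a _ => ?_
    rw [Matrix.transpose_apply, Matrix.mul_apply, real_inner_smul_left, inner_sum]
    congr 1
    refine Finset.sum_congr rfl fun c _ => ?_
    rw [map_smul, ← smul_sub, real_inner_smul_right, hG, Matrix.of_apply, mul_comm]
  rw [dang_sq_eq_det h V W V.onb, dang_sq_eq_det h' V' W' V'.onb, hmat, Matrix.det_mul,
    Matrix.det_mul, Matrix.det_transpose]
  have hGnn : 0 ≤ G.det := by
    rw [hG, ← dang_sq_eq_det h' V' W' V'.onb]; positivity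
  calc R.det * G.det * R.det = R.det ^ 2 * G.det := by ring
    _ ≤ 1 * G.det := by gcongr
    _ = _ := one_mul _

end

/-! ### Transversal families of subspaces -/

/-- Greedy choice of a family of subspaces in which each one makes an angle at least `ρ₀` with some
`k`-dimensional subspace containing the previous ones; the finite set `F` shrinks along the way.
The constant quantifies the independence of the family. -/
theorem exists_quantitatively_independent (h : m + k = n) {ρ₀ t : ℝ} (hρ : 0 < ρ₀) (hρ1 : ρ₀ ≤ 1)
    (ht : 0 ≤ t) (Good : Gr n m → Finset (E n) → Prop)
    (hmono : ∀ V F F', F' ⊆ F → Good V F → Good V F') (A : Finset (E n))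
    (hstep : ∀ F ⊆ A, ∀ W : Gr n k, ∃ V : Gr n m, ρ₀ ≤ dang h V W ∧
      ∃ F' ⊆ F, t * F.card ≤ (F'.card : ℝ) ∧ Good V F') (j : ℕ) (hj : j * m ≤ k + m) :
    ∃ V : Fin j → Gr n m, ∃ F ⊆ A, t ^ j * A.card ≤ (F.card : ℝ) ∧ (∀ i, Good (V i) F) ∧
      (∃ H : Submodule ℝ (E n), Module.finrank ℝ H ≤ j * m ∧ ∀ i, (V i).1 ≤ H) ∧
      ∀ v : Fin j → E n, (∀ i, v i ∈ (V i).1) → ∀ i, ‖v i‖ ≤ (2 / ρ₀) ^ j * ‖∑ i, v i‖ := by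
  induction j with
  | zero =>
    exact ⟨Fin.elim0, A, subset_rfl, by simp, fun i => i.elim0, ⟨⊥, by simp, fun i => i.elim0⟩,
      fun _ _ i => i.elim0⟩
  | succ j ih =>
    have hjm : j * m ≤ k := by
      rw [Nat.succ_mul] at hj
      omega
    obtain ⟨V, F, hFA, hcard, hgood, ⟨H, hH, hVH⟩, hind⟩ := ih (by omega)
    obtain ⟨W, hW⟩ := exists_superspace (k := k) H (hH.trans hjm) (by omega)
    obtain ⟨V', hV', F', hF', hc', hg'⟩ := hstep F hFA W
    refine ⟨Fin.snoc V V', F', hF'.trans hFA, ?_, ?_, ⟨H ⊔ V'.1, ?_, ?_⟩, ?_⟩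
    · calc t ^ (j + 1) * A.card = t * (t ^ j * A.card) := by ring
        _ ≤ t * F.card := by gcongr
        _ ≤ _ := hc'
    · intro i
      induction i using Fin.lastCases with
      | last => simpa using hg'
      | cast i => simpa using hmono _ _ _ hF' (hgood i)
    · have := Submodule.finrank_add_le_finrank_add_finrank H V'.1
      rw [V'.2] at this
      rw [Nat.succ_mul]
      omega
    · intro i
      induction i using Fin.lastCases with
      | last => simp
      | cast i => simpa using (hVH i).trans le_sup_left
    · intro v hv
      rw [Fin.sum_univ_castSucc]
      set u := ∑ i : Fin j, v i.castSucc
      set x := v (Fin.last j)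
      have hvi : ∀ i : Fin j, v i.castSucc ∈ (V i).1 := fun i => by simpa using hv i.castSucc
      have hx : x ∈ V'.1 := by simpa using hv (Fin.last j)
      have hu : u ∈ W.1 := W.1.sum_mem fun i _ => hW (hVH i (hvi i))
      have h1 : ρ₀ * ‖x‖ ≤ ‖u + x‖ := by
        have := dang_mul_norm_le h V' W hx hu
        rw [add_comm] at this
        exact (mul_le_mul_of_nonneg_right hV' (norm_nonneg _)).trans this
      have h2 : ‖x‖ ≤ (1 / ρ₀) * ‖u + x‖ := by
        rw [one_div, inv_mul_eq_div, le_div_iff₀ hρ]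
        linarith
      have hρinv : 1 ≤ 1 / ρ₀ := by rw [le_div_iff₀ hρ]; linarith
      have e : 2 / ρ₀ = 1 / ρ₀ + 1 / ρ₀ := by ring
      have h3 : ‖u‖ ≤ (2 / ρ₀) * ‖u + x‖ := by
        have := norm_sub_le (u + x) x
        rw [add_sub_cancel_right] at this
        rw [e, add_mul]
        nlinarith [norm_nonneg (u + x)]
      have hbase : 1 ≤ 2 / ρ₀ := by rw [e]; linarith
      intro i
      induction i using Fin.lastCases with
      | last =>
        refine h2.trans (mul_le_mul_of_nonneg_right ?_ (norm_nonneg _))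
        calc 1 / ρ₀ ≤ 2 / ρ₀ := by rw [e]; linarith
          _ = (2 / ρ₀) ^ 1 := (pow_one _).symm
          _ ≤ _ := pow_le_pow_right₀ hbase (by omega)
      | cast i =>
        calc ‖v i.castSucc‖ ≤ (2 / ρ₀) ^ j * ‖u‖ := hind (fun i => v i.castSucc) hvi i
          _ ≤ (2 / ρ₀) ^ j * ((2 / ρ₀) * ‖u + x‖) := by gcongr
          _ = _ := by ring

/-- A quantitatively independent family of full dimension spans, so the projections to its members
control the norm. -/
theorem norm_le_sum_proj {q : ℕ} (hq : q * m = n) (V : Fin q → Gr n m) {C : ℝ}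
    (hC : ∀ v : Fin q → E n, (∀ i, v i ∈ (V i).1) → ∀ i, ‖v i‖ ≤ C * ‖∑ i, v i‖) (a : E n) :
    ‖a‖ ≤ C * ∑ i, ‖(V i).proj a‖ := by
  let φ : ((i : Fin q) → (V i).1) →ₗ[ℝ] E n :=
    ∑ i, (V i).1.subtype ∘ₗ LinearMap.proj i
  have hφ : ∀ v, φ v = ∑ i, (v i : E n) := fun v => by simp [φ]
  have hinj : Function.Injective φ := by
    rw [injective_iff_map_eq_zero]
    intro v hv
    ext1 i
    have h1 := hC (fun i => (v i : E n)) (fun i => (v i).2) i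
    rw [← hφ, hv, norm_zero, mul_zero] at h1
    exact Subtype.ext (by simpa using h1)
  have hsurj : Function.Surjective φ := by
    refine (LinearMap.injective_iff_surjective_of_finrank_eq_finrank ?_).1 hinj
    rw [Module.finrank_pi_fintype, finrank_euclideanSpace_fin]
    simp only [fun i => (V i).2, Finset.sum_const, Finset.card_univ, Fintype.card_fin, smul_eq_mul,
      hq]
  obtain ⟨v, hv⟩ := hsurj a
  rw [hφ] at hv
  have h1 := hC (fun i => (v i : E n)) (fun i => (v i).2)
  rw [hv] at h1
  have h2 : ‖a‖ * ‖a‖ ≤ (C * ∑ i, ‖(V i).proj a‖) * ‖a‖ :=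
    calc ‖a‖ * ‖a‖ = ⟪a, ∑ i, (v i : E n)⟫_ℝ := by
          rw [hv, real_inner_self_eq_norm_mul_norm]
      _ = ∑ i, ⟪(V i).proj a, (v i : E n)⟫_ℝ := by
          rw [inner_sum]
          refine Finset.sum_congr rfl fun i _ => ?_
          rw [Gr.proj, Submodule.inner_starProjection_left_eq_right,
            Submodule.starProjection_eq_self_iff.2 (v i).2]
      _ ≤ ∑ i, ‖(V i).proj a‖ * (C * ‖a‖) := by
          refine Finset.sum_le_sum fun i _ => (real_inner_le_norm _ _).trans ?_
          exact mul_le_mul_of_nonneg_left (h1 i) (norm_nonneg _)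
      _ = _ := by rw [← Finset.sum_mul]; ring
  rcases eq_or_ne ‖a‖ 0 with h0 | h0
  · have ha : a = 0 := by simpa using h0
    simp [ha]
  · exact le_of_mul_le_mul_right h2 (lt_of_le_of_ne (norm_nonneg _) (Ne.symm h0))

/-! ### Markov's inequality for outer measures -/

/-- Markov's inequality for a weighted family of sets, which need not be measurable. -/
theorem measureReal_weighted_markov {Ω ι : Type*} [MeasurableSpace Ω] (μ : Measure Ω)
    [IsFiniteMeasure μ] (I : Finset ι) (w : ι → ℝ) (hw : ∀ i ∈ I, 0 ≤ w i) (B : ι → Set Ω)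
    (S : Set Ω) {s : ℝ} (hS : ∀ x ∈ S, s ≤ ∑ i ∈ I, (B i).indicator (fun _ => w i) x) :
    s * μ.real S ≤ ∑ i ∈ I, w i * μ.real (B i) := by
  -- measurable hulls only increase the sum on the right-hand side of `hS`
  let f : Ω → ℝ := fun x => ∑ i ∈ I, (toMeasurable μ (B i)).indicator (fun _ => w i) x
  have hint : ∀ i ∈ I, Integrable ((toMeasurable μ (B i)).indicator fun _ => w i) μ := fun i _ =>
    (integrable_const _).indicator (measurableSet_toMeasurable _ _)
  have hf0 : ∀ x, 0 ≤ f x := fun x =>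
    Finset.sum_nonneg fun i hi => Set.indicator_nonneg (fun _ _ => hw i hi) x
  have hfS : S ⊆ {x | s ≤ f x} := by
    intro x hx
    refine (hS x hx).trans (Finset.sum_le_sum fun i hi => ?_)
    exact Set.indicator_le_indicator_of_subset (subset_toMeasurable _ _) (fun _ => hw i hi) x
  have h1 := mul_meas_ge_le_integral_of_nonneg (Filter.Eventually.of_forall hf0)
    (integrable_finsetSum I hint) s
  have h2 : ∫ x, f x ∂μ = ∑ i ∈ I, w i * μ.real (B i) := by
    rw [integral_finsetSum I hint]
    refine Finset.sum_congr rfl fun i _ => ?_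
    rw [integral_indicator_const _ (measurableSet_toMeasurable _ _), smul_eq_mul, mul_comm,
      measureReal_def, measure_toMeasurable, measureReal_def]
  rcases le_or_gt s 0 with hs | hs
  · refine le_trans (mul_nonpos_of_nonpos_of_nonneg hs measureReal_nonneg) ?_
    exact Finset.sum_nonneg fun i hi => mul_nonneg (hw i hi) measureReal_nonneg
  · rw [← h2]
    exact (mul_le_mul_of_nonneg_left (measureReal_mono hfS) hs.le).trans h1

/-- Suppose that `X` is the disjoint union of parts, up to a small remainder. If every `x ∈ S` has a
large subset `Y` of `X` such that `x` is bad for all the parts that `Y` meets in a large proportion,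
and each part has few bad points, then `S` is small. -/
theorem measureReal_le_of_parts {Ω ι β : Type*} [DecidableEq β] [MeasurableSpace Ω]
    (μ : Measure Ω) [IsProbabilityMeasure μ] (X : Finset β) (hX : X.Nonempty) (I : Finset ι) (part : ι → Finset β)
    (hdisj : (I : Set ι).PairwiseDisjoint part) (hsub : ∀ i ∈ I, part i ⊆ X)
    {t η : ℝ} (ht : 0 < t) (hη : 0 ≤ η)
    (hrem : ((X \ I.biUnion part).card : ℝ) ≤ t / 2 * X.card)
    (bad : ι → Set Ω) (hbad : ∀ i ∈ I, μ.real (bad i) ≤ η) (S : Set Ω)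
    (hS : ∀ x ∈ S, ∃ Y ⊆ X, t * X.card ≤ (Y.card : ℝ) ∧
      ∀ i ∈ I, t / 4 * (part i).card ≤ ((Y ∩ part i).card : ℝ) → x ∈ bad i) :
    μ.real S ≤ 4 * η / t := by
  classical
  have hXc : (0 : ℝ) < X.card := by exact_mod_cast hX.card_pos
  have hsum : ∑ i ∈ I, ((part i).card : ℝ) ≤ X.card := by
    have := Finset.card_le_card (Finset.biUnion_subset.2 hsub)
    rw [Finset.card_biUnion fun i hi j hj hij => hdisj hi hj hij] at this
    exact_mod_cast this
  have key := measureReal_weighted_markov μ I (fun i => ((part i).card : ℝ))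
    (fun _ _ => Nat.cast_nonneg _) bad S (s := t / 4 * X.card) ?_
  · have h2 : ∑ i ∈ I, ((part i).card : ℝ) * μ.real (bad i) ≤ η * X.card :=
      calc _ ≤ ∑ i ∈ I, ((part i).card : ℝ) * η := Finset.sum_le_sum fun i hi =>
            mul_le_mul_of_nonneg_left (hbad i hi) (Nat.cast_nonneg _)
        _ = η * ∑ i ∈ I, ((part i).card : ℝ) := by rw [← Finset.sum_mul, mul_comm]
        _ ≤ _ := by gcongr
    have h3 := key.trans h2
    rw [le_div_iff₀ ht]
    have : (μ.real S * t) * X.card ≤ (4 * η) * X.card := by nlinarith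
    exact le_of_mul_le_mul_right this hXc
  · intro x hx
    obtain ⟨Y, hYX, hYc, hY⟩ := hS x hx
    have h1 : (Y.card : ℝ) ≤ (X \ I.biUnion part).card + ∑ i ∈ I, ((Y ∩ part i).card : ℝ) := by
      have e : Y ⊆ (X \ I.biUnion part) ∪ I.biUnion fun i => Y ∩ part i := by
        intro y hy
        by_cases hmem : y ∈ I.biUnion part
        · obtain ⟨i, hi, hyi⟩ := Finset.mem_biUnion.1 hmem
          exact Finset.mem_union_right _
            (Finset.mem_biUnion.2 ⟨i, hi, Finset.mem_inter.2 ⟨hy, hyi⟩⟩)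
        · exact Finset.mem_union_left _ (Finset.mem_sdiff.2 ⟨hYX hy, hmem⟩)
      have := ((Finset.card_le_card e).trans (Finset.card_union_le _ _)).trans
        (Nat.add_le_add_left Finset.card_biUnion_le _)
      exact_mod_cast this
    have h2 : ∀ i ∈ I, ((Y ∩ part i).card : ℝ) ≤
        (bad i).indicator (fun _ => ((part i).card : ℝ)) x + t / 4 * (part i).card := by
      intro i hi
      by_cases hb : x ∈ bad i
      · rw [Set.indicator_of_mem hb]
        have : ((Y ∩ part i).card : ℝ) ≤ (part i).card := by
          exact_mod_cast Finset.card_le_card Finset.inter_subset_right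
        have : 0 ≤ t / 4 * ((part i).card : ℝ) := by positivity
        linarith
      · rw [Set.indicator_of_notMem hb, zero_add]
        by_contra hcon
        exact hb (hY i hi (not_le.1 hcon).le)
    have h3 := Finset.sum_le_sum h2
    rw [Finset.sum_add_distrib, ← Finset.mul_sum] at h3
    have h4 : t / 4 * ∑ i ∈ I, ((part i).card : ℝ) ≤ t / 4 * X.card := by gcongr
    linarith

/-! ### Tubes over projections -/

open Classical in
/-- A Kaufman-type estimate: if `A` has little mass in balls of radius `R` and `μ` has little mass near
every `W`, then for most `V` no tube `π_V⁻¹ (B(y, r / 2))` contains a large proportion of `A`. -/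
theorem measureReal_heavy_tube_mul_sq_le (h : m + k = n) (hm : 0 < m) (μ : Measure (Gr n m))
    [IsProbabilityMeasure μ] (A : Finset (E n)) (hA : A.Nonempty) {K₁ K₂ R r s : ℝ} (hR : 0 < R)
    (hK₁ : ∀ x, ((A.filter fun a => dist a x ≤ R).card : ℝ) ≤ K₁ * A.card)
    (hK₂ : ∀ W : Gr n k, μ.real (Vang h W (r / R)) ≤ K₂) (hs : 0 ≤ s) :
    s ^ 2 * μ.real {V : Gr n m | ∃ y, s * A.card < ((A.filter fun a =>
      dist (V.proj a) y ≤ r / 2).card : ℝ)} ≤ K₁ + K₂ := by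
  set S := {V : Gr n m | ∃ y, s * A.card < ((A.filter fun a =>
      dist (V.proj a) y ≤ r / 2).card : ℝ)}
  have hAc : (0 : ℝ) < A.card := by exact_mod_cast hA.card_pos
  let B : E n × E n → Set (Gr n m) := fun p => {V | dist (V.proj p.1) (V.proj p.2) ≤ r}
  have key := measureReal_weighted_markov μ (A ×ˢ A) (fun _ => (1 : ℝ)) (fun _ _ => zero_le_one)
    B S (s := s ^ 2 * (A.card : ℝ) ^ 2) ?_
  · have hpair : ∀ a b : E n, R < dist a b → μ.real (B (a, b)) ≤ K₂ := by
      intro a b hab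
      obtain ⟨W, hW⟩ := exists_orthogonal_subspace h hm (a - b)
      refine (measureReal_mono ?_).trans (hK₂ W)
      intro V hV
      have h1 := dang_mul_norm_le_proj h V W hW
      rw [map_sub] at h1
      have h2 : ‖V.proj a - V.proj b‖ ≤ r := by rw [← dist_eq_norm]; exact hV
      rw [dist_eq_norm] at hab
      change dang h V W ≤ r / R
      rw [le_div_iff₀ hR]
      refine le_trans ?_ (h1.trans h2)
      exact mul_le_mul_of_nonneg_left hab.le (dang_nonneg h V W)
    have hK₂0 : 0 ≤ K₂ := by
      obtain ⟨W, -⟩ := exists_orthogonal_subspace h hm (0 : E n)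
      exact measureReal_nonneg.trans (hK₂ W)
    have hsum : ∑ p ∈ A ×ˢ A, 1 * μ.real (B p) ≤ (K₁ + K₂) * (A.card : ℝ) ^ 2 := by
      rw [Finset.sum_product]
      have hrow : ∀ a ∈ A, ∑ b ∈ A, 1 * μ.real (B (a, b)) ≤ (K₁ + K₂) * A.card := by
        intro a _
        have : ∀ b ∈ A, 1 * μ.real (B (a, b)) ≤ (if dist b a ≤ R then 1 else 0) + K₂ := by
          intro b _
          rw [one_mul]
          split_ifs with hd
          · linarith [measureReal_le_one (μ := μ) (s := B (a, b))]
          · rw [zero_add]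
            exact hpair a b (by rw [dist_comm]; exact not_le.1 hd)
        refine (Finset.sum_le_sum this).trans ?_
        rw [Finset.sum_add_distrib, Finset.sum_const, nsmul_eq_mul, Finset.sum_boole]
        linarith [hK₁ a]
      refine (Finset.sum_le_sum hrow).trans (le_of_eq ?_)
      rw [Finset.sum_const, nsmul_eq_mul]
      ring
    have h3 := key.trans hsum
    have h4 : (s ^ 2 * μ.real S) * (A.card : ℝ) ^ 2 ≤ (K₁ + K₂) * (A.card : ℝ) ^ 2 := by
      linarith
    exact le_of_mul_le_mul_right h4 (by positivity)
  · rintro V ⟨y, hy⟩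
    set T := A.filter fun a => dist (V.proj a) y ≤ r / 2
    have hTT : ((T ×ˢ T).card : ℝ) ≤
        ∑ p ∈ A ×ˢ A, (B p).indicator (fun _ => (1 : ℝ)) V := by
      rw [Finset.card_eq_sum_ones, Nat.cast_sum]
      have hsub : T ×ˢ T ⊆ A ×ˢ A :=
        Finset.product_subset_product (Finset.filter_subset _ _) (Finset.filter_subset _ _)
      refine le_trans (Finset.sum_le_sum fun p hp => ?_)
        (Finset.sum_le_sum_of_subset_of_nonneg hsub fun p _ _ =>
          Set.indicator_nonneg (fun _ _ => zero_le_one) V)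
      obtain ⟨h1, h2⟩ := Finset.mem_product.1 hp
      have e1 := (Finset.mem_filter.1 h1).2
      have e2 := (Finset.mem_filter.1 h2).2
      have : V ∈ B p := by
        change dist _ _ ≤ r
        linarith [dist_triangle_right (V.proj p.1) (V.proj p.2) y]
      rw [Set.indicator_of_mem this]
      simp
    refine le_trans ?_ hTT
    rw [Finset.card_product, Nat.cast_mul, ← mul_pow, ← pow_two]
    exact pow_le_pow_left₀ (by positivity) hy.le 2

/-! ### From one good subset to the whole set -/

theorem eventually_le_rpow_neg (C : ℝ) {x : ℝ} (hx : 0 < x) : ∀ᶠ δ in 𝓝[>] (0 : ℝ), C ≤ δ ^ (-x) :=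
  (tendsto_rpow_neg_nhdsGT_zero (neg_neg_of_pos hx)).eventually_ge_atTop C

open Classical in
/-- The projection theorem bounds the exceptional set of *some* subset of `A`. Removing such subsets
one after the other exhausts `A` up to a small remainder, so that the exceptional set of `A` itself
is small. -/
theorem ProjectionTheorem.measure_EC_le (hP : ProjectionTheorem n m) (h : m + k = n) (hm : 0 < m)
    (hk : 0 < k) {α κ : ℝ} (hα : 0 < α) (hαn : α < n) (hκ : 0 < κ) :
    ∃ η : ℝ, 0 < η ∧ ∀ᶠ δ in 𝓝[>] (0 : ℝ), ∀ (B : Finset (E n)) (μ : Measure (Gr n m)),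
      (B : Set (E n)) ⊆ Metric.closedBall 0 1 → IsProbabilityMeasure μ →
      ((B : Set (E n)).Pairwise fun x y => 2 * δ < dist x y) →
      δ ^ (-α + η) ≤ B.card →
      (∀ ρ, δ ≤ ρ → ∀ x, ((B.filter fun a => dist a x ≤ ρ).card : ℝ) ≤
        δ ^ (-η) * ρ ^ κ * B.card) →
      (∀ ρ, δ ≤ ρ → ∀ W : Gr n k, μ.real (Vang h W ρ) ≤ δ ^ (-η) * ρ ^ κ) →
      μ.real (EC δ α (B : Set (E n)) η) ≤ δ ^ η := by
  obtain rfl : k = n - m := by omega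
  obtain ⟨ε, hε, δ₀, hδ₀, H⟩ := hP hm (by omega) α κ hα hαn hκ
  set η := ε / 4 with hη
  have hη0 : 0 < η := by positivity
  have hεη : ε = 4 * η := by rw [hη]; ring
  refine ⟨η, hη0, ?_⟩
  filter_upwards [self_mem_nhdsWithin, Ioo_mem_nhdsGT hδ₀, Ioo_mem_nhdsGT one_pos,
    eventually_le_rpow_neg 4 hη0] with δ hδ hδδ₀ hδ1 h4 B μ hB1 hμ hBsep hBcard hBball hμang
  replace hδ : 0 < δ := hδ
  have hδ1 : δ < 1 := hδ1.2
  have hpos : ∀ x : ℝ, 0 < δ ^ x := fun x => Real.rpow_pos_of_pos hδ x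
  have hanti : ∀ {x y : ℝ}, x ≤ y → δ ^ y ≤ δ ^ x := fun hxy =>
    Real.rpow_le_rpow_of_exponent_ge hδ hδ1.le hxy
  have hmul : ∀ x y : ℝ, δ ^ x * δ ^ y = δ ^ (x + y) := fun x y => (Real.rpow_add hδ x y).symm
  have h4' : 4 * δ ^ η ≤ 1 := by
    calc 4 * δ ^ η ≤ δ ^ (-η) * δ ^ η := by gcongr
      _ = 1 := by rw [hmul, neg_add_cancel, Real.rpow_zero]
  have hBc : (0 : ℝ) < B.card := (hpos _).trans_le hBcard
  have hBne : B.Nonempty := Finset.card_pos.1 (by exact_mod_cast hBc)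
  -- a disjoint family of good parts whose union is as large as possible
  let Fam : Finset (Finset (Finset (E n))) := B.powerset.powerset.filter fun I =>
    (I : Set (Finset (E n))).PairwiseDisjoint id ∧
      ∀ p ∈ I, μ.real (EC δ α (p : Set (E n)) ε) ≤ δ ^ ε
  obtain ⟨I, hI, hmax⟩ := Fam.exists_max_image (fun I => (I.biUnion id).card)
    ⟨∅, by simp [Fam]⟩
  obtain ⟨hIB, hIdisj, hIgood⟩ := Finset.mem_filter.1 hI
  have hIsub : ∀ p ∈ I, p ⊆ B := fun p hp =>
    Finset.mem_powerset.1 (Finset.mem_powerset.1 hIB hp)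
  have hrem : ((B \ I.biUnion id).card : ℝ) ≤ δ ^ η / 2 * B.card := by
    by_contra! hcon
    set R := B \ I.biUnion id with hR
    have hRB : R ⊆ B := Finset.sdiff_subset
    have hRN : Ncov δ (R : Set (E n)) = R.card :=
      Ncov_eq_card hδ (hBsep.mono (by exact_mod_cast hRB))
    obtain ⟨A', hA'R, hA'⟩ := H δ hδ hδδ₀.2 R μ (subset_trans (by exact_mod_cast hRB) hB1) hμ
      (by
        rw [hRN]
        refine le_trans ?_ hcon.le
        calc δ ^ (-α + ε) = δ ^ (-α + η) * δ ^ η * δ ^ (2 * η) := by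
              rw [hmul, hmul, hεη]; ring_nf
          _ ≤ B.card * δ ^ η * (1 / 2) := by
              have h2 : δ ^ (2 * η) = δ ^ η * δ ^ η := by rw [hmul]; ring_nf
              have h3 : δ ^ (2 * η) ≤ 1 / 2 := by rw [h2]; nlinarith [hpos η]
              exact mul_le_mul (mul_le_mul_of_nonneg_right hBcard (hpos η).le) h3 (hpos _).le
                (mul_nonneg hBc.le (hpos η).le)
          _ = _ := by ring)
      (by
        intro ρ hρ x
        have hρ0 : 0 < ρ := hδ.trans_le hρ
        have e : (R : Set (E n)) ∩ Metric.closedBall x ρ =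
            ((R.filter fun a => dist a x ≤ ρ : Finset (E n)) : Set (E n)) := by
          ext a; simp
        rw [e, Ncov_eq_card hδ (hBsep.mono (by
          exact_mod_cast (Finset.filter_subset _ _).trans hRB)), hRN]
        have h1 : ((R.filter fun a => dist a x ≤ ρ).card : ℝ) ≤
            (B.filter fun a => dist a x ≤ ρ).card := by
          exact_mod_cast Finset.card_le_card (Finset.filter_subset_filter _ hRB)
        have h2 : (B.card : ℝ) ≤ 2 * δ ^ (-η) * R.card := by
          have : δ ^ (-η) * δ ^ η = 1 := by rw [hmul, neg_add_cancel, Real.rpow_zero]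
          calc (B.card : ℝ) = 2 * δ ^ (-η) * (δ ^ η / 2 * B.card) := by
                linear_combination (-(B.card : ℝ)) * this
            _ ≤ _ := by
                have := hpos (-η)
                gcongr
        have h0 := hpos (-η)
        have hρκ : 0 < ρ ^ κ := Real.rpow_pos_of_pos hρ0 κ
        calc ((R.filter fun a => dist a x ≤ ρ).card : ℝ) ≤ δ ^ (-η) * ρ ^ κ * B.card :=
              h1.trans (hBball ρ hρ x)
          _ ≤ δ ^ (-η) * ρ ^ κ * (2 * δ ^ (-η) * R.card) := by gcongr
          _ = (2 * (δ ^ (-η) * δ ^ (-η))) * ρ ^ κ * R.card := by ring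
          _ ≤ δ ^ (-ε) * ρ ^ κ * R.card := by
              refine mul_le_mul_of_nonneg_right (mul_le_mul_of_nonneg_right ?_ hρκ.le)
                (Nat.cast_nonneg _)
              calc 2 * (δ ^ (-η) * δ ^ (-η)) ≤ δ ^ (-η) * (δ ^ (-η) * δ ^ (-η)) := by
                    gcongr; linarith
                _ = δ ^ (-(3 * η)) := by rw [hmul, hmul]; ring_nf
                _ ≤ δ ^ (-ε) := hanti (by rw [hεη]; linarith))
      (by
        intro ρ hρ W
        refine (hμang ρ hρ W).trans ?_
        have hρκ : 0 < ρ ^ κ := Real.rpow_pos_of_pos (hδ.trans_le hρ) κ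
        have : δ ^ (-η) ≤ δ ^ (-ε) := hanti (by rw [hεη]; linarith)
        gcongr)
    -- the part is nonempty, since every direction is exceptional for the empty set
    have hne : A'.Nonempty := by
      by_contra hemp
      rw [Set.not_nonempty_iff_eq_empty] at hemp
      subst hemp
      have huniv : (EC δ α (∅ : Set (E n)) ε : Set (Gr n m)) = Set.univ := by
        ext V
        simp only [EC, Set.mem_ofPred_eq, Set.mem_univ, iff_true]
        refine ⟨∅, subset_rfl, ?_, ?_⟩ <;>
          simp [Ncov, Metric.externalCoveringNumber_empty, hpos]
      rw [huniv, probReal_univ] at hA'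
      have := hanti (show η ≤ ε by rw [hεη]; linarith)
      linarith [hpos η]
    let p : Finset (E n) := R.filter fun a => a ∈ A'
    have hpA : (p : Set (E n)) = A' := by
      ext a; simp only [p, Finset.coe_filter, Set.mem_ofPred_eq]
      exact ⟨fun hh => hh.2, fun hh => ⟨hA'R hh, hh⟩⟩
    have hpR : p ⊆ R := Finset.filter_subset _ _
    have hpdisj : Disjoint p (I.biUnion id) :=
      Finset.disjoint_of_subset_left hpR Finset.sdiff_disjoint
    have hpne : p.Nonempty := by
      rw [← Finset.coe_nonempty, hpA]; exact hne
    have hmem : insert p I ∈ Fam := by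
      refine Finset.mem_filter.2 ⟨?_, ?_, ?_⟩
      · rw [Finset.mem_powerset, Finset.insert_subset_iff]
        exact ⟨Finset.mem_powerset.2 (hpR.trans hRB), Finset.mem_powerset.1 hIB⟩
      · rw [Finset.coe_insert]
        refine hIdisj.insert fun j hj _ => ?_
        exact Finset.disjoint_of_subset_right (Finset.subset_biUnion_of_mem id hj) hpdisj
      · intro p' hp'
        rcases Finset.mem_insert.1 hp' with rfl | hp'
        · rw [hpA]; exact hA'
        · exact hIgood p' hp'
    have hlt := hmax _ hmem
    rw [Finset.biUnion_insert, id, Finset.card_union_of_disjoint hpdisj] at hlt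
    have := hpne.card_pos
    omega
  have hfin := measureReal_le_of_parts μ B hBne I id hIdisj hIsub (hpos η) (hpos ε).le hrem
    (fun p => EC δ α (p : Set (E n)) ε) hIgood (EC δ α (B : Set (E n)) η) ?_
  · refine hfin.trans ?_
    rw [div_le_iff₀ (hpos η), hmul]
    calc 4 * δ ^ ε = 4 * δ ^ η * δ ^ (3 * η) := by rw [mul_assoc, hmul, hεη]; ring_nf
      _ ≤ 1 * δ ^ (3 * η) := by have := hpos (3 * η); gcongr
      _ ≤ δ ^ (η + η) := by rw [one_mul]; exact hanti (by linarith)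
  · rintro V ⟨A', hA'B, hcard, hproj⟩
    let Y : Finset (E n) := B.filter fun a => a ∈ A'
    have hYA : (Y : Set (E n)) = A' := by
      ext a; simp only [Y, Finset.coe_filter, Set.mem_ofPred_eq]
      exact ⟨fun hh => hh.2, fun hh => ⟨hA'B hh, hh⟩⟩
    have hYB : Y ⊆ B := Finset.filter_subset _ _
    rw [← hYA, Ncov_eq_card hδ hBsep, Ncov_eq_card hδ (hBsep.mono (by exact_mod_cast hYB))] at hcard
    refine ⟨Y, hYB, hcard, fun p hp hYp => ?_⟩
    have hpB := hIsub p hp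
    refine ⟨((Y ∩ p : Finset (E n)) : Set (E n)), by
      exact_mod_cast (Finset.inter_subset_right : Y ∩ p ⊆ p), ?_, ?_⟩
    · rw [Ncov_eq_card hδ (hBsep.mono (by exact_mod_cast hpB)),
        Ncov_eq_card hδ (hBsep.mono (by
          exact_mod_cast (Finset.inter_subset_right : Y ∩ p ⊆ p).trans hpB))]
      refine le_trans ?_ hYp
      refine mul_le_mul_of_nonneg_right ?_ (Nat.cast_nonneg _)
      calc δ ^ ε = δ ^ η * δ ^ (3 * η) := by rw [hmul, hεη]; ring_nf
        _ ≤ δ ^ η * (1 / 4) := by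
            have := hpos η
            gcongr
            exact (hanti (show η ≤ 3 * η by linarith)).trans (by linarith)
        _ = _ := by ring
    · have h1 : Ncov δ (V.proj '' ((Y ∩ p : Finset (E n)) : Set (E n))) ≤ Ncov δ (V.proj '' A') := by
        rw [← hYA]
        exact Ncov_mono hδ (Y.finite_toSet.image _).isBounded
          (Set.image_mono (by exact_mod_cast Finset.inter_subset_left))
      refine lt_of_le_of_lt (by exact_mod_cast h1) (hproj.trans_le ?_)
      exact hanti (by rw [hεη]; linarith)

/-! ### Directions without heavy tubes at any scale -/

/-- Every scale in `[δ, 1]` is within a factor `δ ^ (-1 / J)` of one of the `J + 1` scales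
`δ ^ (j / J)`. -/
theorem exists_discrete_scale {J : ℕ} (hJ : 0 < J) (hδ : 0 < δ) (hδ1 : δ < 1) {ρ : ℝ} (hρ : δ ≤ ρ)
    (hρ1 : ρ ≤ 1) : ∃ j ∈ Finset.range (J + 1), ρ ≤ δ ^ ((j : ℝ) / J) ∧
      δ ^ ((j : ℝ) / J) ≤ ρ * δ ^ (-(1 / J : ℝ)) := by
  have hρ0 : 0 < ρ := hδ.trans_le hρ
  have hlog : Real.log δ < 0 := Real.log_neg hδ hδ1
  set y := Real.log ρ / Real.log δ with hy
  have hy0 : 0 ≤ y := div_nonneg_of_nonpos (Real.log_nonpos hρ0.le hρ1) hlog.le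
  have hy1 : y ≤ 1 := by
    rw [hy, div_le_one_of_neg hlog]
    exact Real.log_le_log hδ hρ
  have hρy : ρ = δ ^ y := by
    rw [Real.rpow_def_of_pos hδ, hy, mul_div_cancel₀ _ hlog.ne, Real.exp_log hρ0]
  have hJ' : (0 : ℝ) < J := by exact_mod_cast hJ
  refine ⟨⌊(J : ℝ) * y⌋₊, ?_, ?_, ?_⟩
  · rw [Finset.mem_range, Nat.lt_succ_iff]
    refine Nat.floor_le_of_le ?_
    calc (J : ℝ) * y ≤ J * 1 := by gcongr
      _ = J := mul_one _
  · rw [hρy]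
    refine Real.rpow_le_rpow_of_exponent_ge hδ hδ1.le ?_
    rw [div_le_iff₀ hJ', mul_comm]
    exact Nat.floor_le (by positivity)
  · rw [hρy, ← Real.rpow_add hδ]
    refine Real.rpow_le_rpow_of_exponent_ge hδ hδ1.le ?_
    have := Nat.lt_floor_add_one ((J : ℝ) * y)
    rw [← sub_eq_add_neg, sub_le_iff_le_add, ← add_div, le_div_iff₀ hJ']
    linarith

open Classical in
/-- For all `V` outside a set of small measure, the mass of `A` in the tubes over balls of radius `ρ`
in `V` decays like a power of `ρ`, uniformly in the scale. -/
theorem eventually_exists_no_heavy_tube (h : m + k = n) (hm : 0 < m) {ε κ c : ℝ} (hε : 0 < ε)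
    (hκ : 0 < κ) (hc : 1 ≤ c) :
    ∀ᶠ δ in 𝓝[>] (0 : ℝ), ∀ (A : Finset (E n)) (μ : Measure (Gr n m)), A.Nonempty →
      IsProbabilityMeasure μ →
      (∀ ρ, δ ≤ ρ → ∀ x, ((A.filter fun a => dist a x ≤ ρ).card : ℝ) ≤
        δ ^ (-(2 * ε)) * ρ ^ κ * A.card) →
      (∀ ρ, δ ≤ ρ → ∀ W : Gr n k, μ.real (Vang h W ρ) ≤ δ ^ (-ε) * ρ ^ κ) →
      ∃ Bad : Set (Gr n m), μ.real Bad ≤ δ ^ (2 * ε) ∧ ∀ V ∉ Bad, ∀ ρ, δ ≤ ρ → ρ ≤ 1 → ∀ y,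
        ((A.filter fun a => dist (V.proj a) y ≤ c * ρ).card : ℝ) ≤
          δ ^ (-(4 * ε)) * ρ ^ (κ / 4) * A.card := by
  -- with this many scales, rounding to the next scale costs at most `δ ^ (-ε)`
  obtain ⟨J, hJ⟩ := exists_nat_gt (κ / 4 / ε)
  have hJ0' : (0 : ℝ) < J := lt_trans (by positivity) hJ
  have hJ0 : 0 < J := by exact_mod_cast hJ0'
  have hJε : 1 / (J : ℝ) * (κ / 4) ≤ ε := by
    rw [one_div, inv_mul_le_iff₀ hJ0', mul_comm]
    rw [div_lt_iff₀ hε, mul_comm] at hJ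
    exact hJ.le
  filter_upwards [self_mem_nhdsWithin, Ioo_mem_nhdsGT one_pos,
    eventually_le_rpow_neg (1 + (2 * c) ^ κ) hε, eventually_le_rpow_neg (J + 1) hε] with
    δ hδ hδ1 hconst hscales A μ hA hμ hball hang
  replace hδ : 0 < δ := hδ
  have hδ1 : δ < 1 := hδ1.2
  have hpos : ∀ x : ℝ, 0 < δ ^ x := fun x => Real.rpow_pos_of_pos hδ x
  have hmul : ∀ x y : ℝ, δ ^ x * δ ^ y = δ ^ (x + y) := fun x y => (Real.rpow_add hδ x y).symm
  let σ : ℕ → ℝ := fun j => δ ^ ((j : ℝ) / J)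
  let S : ℕ → Set (Gr n m) := fun j => {V | ∃ y, δ ^ (-(3 * ε)) * σ j ^ (κ / 4) * A.card <
    ((A.filter fun a => dist (V.proj a) y ≤ 2 * c * σ j / 2).card : ℝ)}
  have hσpos : ∀ j, 0 < σ j := fun j => hpos _
  have hS : ∀ j ∈ Finset.range (J + 1), μ.real (S j) ≤ δ ^ (3 * ε) := by
    intro j hj
    have hjJ : (j : ℝ) / J ≤ 1 := by
      rw [div_le_one hJ0']
      exact_mod_cast Nat.lt_succ_iff.1 (Finset.mem_range.1 hj)
    have hσ1 : σ j ≤ 1 := Real.rpow_le_one hδ.le hδ1.le (by positivity)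
    have hσδ : δ ≤ σ j := by
      conv_lhs => rw [← Real.rpow_one δ]
      exact Real.rpow_le_rpow_of_exponent_ge hδ hδ1.le hjJ
    -- `R = √σ` balances the balls of radius `R` against the angles of size `σ / R`
    set R := √(σ j) with hR
    have hR0 : 0 < R := Real.sqrt_pos.2 (hσpos j)
    have hRσ : R * R = σ j := Real.mul_self_sqrt (hσpos j).le
    have hR1 : R ≤ 1 := by rw [hR]; exact Real.sqrt_le_one.2 hσ1
    have hRδ : δ ≤ R := by nlinarith
    have hrR : 2 * c * σ j / R = 2 * c * R := by
      rw [← hRσ]; field_simp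
    have hRκ : R ^ κ = σ j ^ (κ / 2) := by
      rw [hR, Real.sqrt_eq_rpow, ← Real.rpow_mul (hσpos j).le]
      congr 1; ring
    have key := measureReal_heavy_tube_mul_sq_le h hm μ A hA (K₁ := δ ^ (-(2 * ε)) * R ^ κ)
      (K₂ := δ ^ (-ε) * (2 * c * R) ^ κ) (r := 2 * c * σ j)
      (s := δ ^ (-(3 * ε)) * σ j ^ (κ / 4)) hR0 (hball R hRδ)
      (fun W => by
        rw [hrR]
        exact hang _ (hRδ.trans (by nlinarith)) W)
      (mul_nonneg (hpos _).le (Real.rpow_nonneg (hσpos j).le _))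
    have hs2 : (δ ^ (-(3 * ε)) * σ j ^ (κ / 4)) ^ 2 = δ ^ (-(6 * ε)) * R ^ κ := by
      rw [mul_pow, hRκ, pow_two, pow_two, hmul, ← Real.rpow_add (hσpos j)]
      ring_nf
    have hRκ0 : 0 < R ^ κ := Real.rpow_pos_of_pos hR0 κ
    have hrhs : δ ^ (-(2 * ε)) * R ^ κ + δ ^ (-ε) * (2 * c * R) ^ κ ≤ δ ^ (-(3 * ε)) * R ^ κ := by
      rw [Real.mul_rpow (by positivity) hR0.le]
      have h1 : δ ^ (-ε) ≤ δ ^ (-(2 * ε)) :=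
        Real.rpow_le_rpow_of_exponent_ge hδ hδ1.le (by linarith)
      have h2 : 0 < (2 * c) ^ κ := Real.rpow_pos_of_pos (by positivity) κ
      calc _ ≤ δ ^ (-(2 * ε)) * R ^ κ + δ ^ (-(2 * ε)) * ((2 * c) ^ κ * R ^ κ) := by gcongr
        _ = (1 + (2 * c) ^ κ) * δ ^ (-(2 * ε)) * R ^ κ := by ring
        _ ≤ δ ^ (-ε) * δ ^ (-(2 * ε)) * R ^ κ := by
            have := hpos (-(2 * ε))
            gcongr
        _ = _ := by rw [hmul]; ring_nf
    have h3 := key.trans hrhs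
    rw [hs2] at h3
    have h4 : δ ^ (-(6 * ε)) * μ.real (S j) ≤ δ ^ (-(3 * ε)) := by
      refine le_of_mul_le_mul_right ?_ hRκ0
      calc _ = δ ^ (-(6 * ε)) * R ^ κ * μ.real (S j) := by ring
        _ ≤ _ := h3
    have h5 : μ.real (S j) = δ ^ (6 * ε) * (δ ^ (-(6 * ε)) * μ.real (S j)) := by
      rw [← mul_assoc, hmul, add_neg_cancel, Real.rpow_zero, one_mul]
    rw [h5]
    calc _ ≤ δ ^ (6 * ε) * δ ^ (-(3 * ε)) := mul_le_mul_of_nonneg_left h4 (hpos _).le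
      _ = δ ^ (3 * ε) := by rw [hmul]; ring_nf
  refine ⟨⋃ j ∈ Finset.range (J + 1), S j, ?_, ?_⟩
  · refine (measureReal_biUnion_finset_le _ _).trans ((Finset.sum_le_sum hS).trans ?_)
    rw [Finset.sum_const, Finset.card_range, nsmul_eq_mul]
    push_cast
    calc ((J : ℝ) + 1) * δ ^ (3 * ε) ≤ δ ^ (-ε) * δ ^ (3 * ε) := by
          have := hpos (3 * ε)
          gcongr
      _ = _ := by rw [hmul]; ring_nf
  · intro V hV ρ hρ hρ1 y
    obtain ⟨j, hj, h1, h2⟩ := exists_discrete_scale hJ0 hδ hδ1 hρ hρ1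
    have hρ0 : 0 < ρ := hδ.trans_le hρ
    have hVj : V ∉ S j := fun hmem => hV (Set.mem_biUnion hj hmem)
    have h3 : ((A.filter fun a => dist (V.proj a) y ≤ 2 * c * σ j / 2).card : ℝ) ≤
        δ ^ (-(3 * ε)) * σ j ^ (κ / 4) * A.card := by
      by_contra hcon
      exact hVj ⟨y, not_le.1 hcon⟩
    have h4 : ((A.filter fun a => dist (V.proj a) y ≤ c * ρ).card : ℝ) ≤
        (A.filter fun a => dist (V.proj a) y ≤ 2 * c * σ j / 2).card := by
      refine Nat.cast_le.2 (Finset.card_le_card ?_)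
      refine Finset.monotone_filter_right _ fun a _ ha => ?_
      refine le_trans ha ?_
      have : c * ρ ≤ c * σ j := by gcongr
      linarith
    refine (h4.trans h3).trans ?_
    have h5 : σ j ^ (κ / 4) ≤ δ ^ (-ε) * ρ ^ (κ / 4) :=
      calc σ j ^ (κ / 4) ≤ (ρ * δ ^ (-(1 / J : ℝ))) ^ (κ / 4) :=
            Real.rpow_le_rpow (hσpos j).le h2 (by positivity)
        _ = δ ^ (-(1 / J : ℝ) * (κ / 4)) * ρ ^ (κ / 4) := by
            rw [Real.mul_rpow hρ0.le (hpos _).le, ← Real.rpow_mul hδ.le, mul_comm]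
        _ ≤ δ ^ (-ε) * ρ ^ (κ / 4) := by
            have := Real.rpow_pos_of_pos hρ0 (κ / 4)
            gcongr ?_ * _
            exact Real.rpow_le_rpow_of_exponent_ge hδ hδ1.le (by linarith)
    calc δ ^ (-(3 * ε)) * σ j ^ (κ / 4) * A.card
        ≤ δ ^ (-(3 * ε)) * (δ ^ (-ε) * ρ ^ (κ / 4)) * A.card := by
          have := hpos (-(3 * ε))
          gcongr
      _ = δ ^ (-(4 * ε)) * ρ ^ (κ / 4) * A.card := by
          rw [← mul_assoc, hmul]; ring_nf

/-! ### Fibres of projections -/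

open Classical in
/-- Passing to at least half of the points, all the nonempty fibres (over the balls of a minimal cover
of the projection) have at least half of the average cardinality. -/
theorem exists_large_fibers (hδ : 0 < δ) (F : Finset (E n)) (f : E n → E l) :
    ∃ c : E n → E l, (∀ a ∈ F, dist (f a) (c a) ≤ δ) ∧ ∃ F' ⊆ F, (F.card : ℝ) ≤ 2 * F'.card ∧
      ∀ a ∈ F', (F.card : ℝ) ≤ 2 * Ncov δ (f '' F) * (F'.filter fun b => c b = c a).card := by
  obtain ⟨t, ht, hc⟩ := exists_finset_cover hδ (F.finite_toSet.image f).isBounded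
  have hc' : ∀ a ∈ F, ∃ x ∈ t, dist (f a) x ≤ δ := fun a ha => hc _ ⟨a, ha, rfl⟩
  choose! c hct hcd using hc'
  refine ⟨c, hcd, F.filter fun a =>
    (F.card : ℝ) ≤ 2 * Ncov δ (f '' F) * (F.filter fun b => c b = c a).card,
    Finset.filter_subset _ _, ?_, ?_⟩
  · set N := Ncov δ (f '' F)
    rcases F.eq_empty_or_nonempty with rfl | ⟨a₀, ha₀⟩
    · simp
    have hN : (0 : ℝ) < N := by
      rw [← ht]
      exact_mod_cast Finset.card_pos.2 ⟨_, hct a₀ ha₀⟩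
    set P : E n → Prop := fun a =>
      (F.card : ℝ) ≤ 2 * N * (F.filter fun b => c b = c a).card
    have hrem := card_le_mul_of_fiber (F.filter fun a => ¬ P a) t c
      (fun a ha => hct a (Finset.mem_filter.1 ha).1) (K := F.card / (2 * N)) (fun x _ => by
        rcases ((F.filter fun a => ¬ P a).filter fun a => c a = x).eq_empty_or_nonempty with
          he | ⟨a, ha⟩
        · rw [he, Finset.card_empty, Nat.cast_zero]; positivity
        · obtain ⟨ha1, rfl⟩ := Finset.mem_filter.1 ha
          have ha2 := (Finset.mem_filter.1 ha1).2
          have h1 : (((F.filter fun a => ¬ P a).filter fun b => c b = c a).card : ℝ) ≤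
              (F.filter fun b => c b = c a).card :=
            Nat.cast_le.2 (Finset.card_le_card
              (Finset.filter_subset_filter _ (Finset.filter_subset _ _)))
          refine h1.trans ?_
          rw [le_div_iff₀ (by positivity), mul_comm]
          exact (not_le.1 ha2).le)
    rw [ht] at hrem
    have e : (F.card : ℝ) / (2 * N) * N = F.card / 2 := by field_simp
    rw [e] at hrem
    have hsplit : ((F.filter P).card : ℝ) + (F.filter fun a => ¬ P a).card = F.card := by
      exact_mod_cast Finset.card_filter_add_card_filter_not (s := F) P
    linarith
  · intro a ha
    obtain ⟨haF, ha2⟩ := Finset.mem_filter.1 ha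
    refine ha2.trans (le_of_eq ?_)
    congr 3
    ext b
    simp only [Finset.mem_filter]
    constructor
    · rintro ⟨hb, hba⟩
      exact ⟨⟨hb, by rw [hba]; exact ha2⟩, hba⟩
    · rintro ⟨⟨hb, -⟩, hba⟩
      exact ⟨hb, hba⟩

open Classical in
/-- When all the fibres are large, a light tube projects to a small set. -/
theorem Ncov_mul_card_le_of_large_fibers (hδ : 0 < δ) {F F' G : Finset (E n)} {f c : E n → E l}
    (hF' : F' ⊆ F) (hG : G ⊆ F') (hc : ∀ a ∈ F, dist (f a) (c a) ≤ δ) {N : ℝ} (hN : 0 ≤ N)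
    (hfib : ∀ a ∈ F', (F.card : ℝ) ≤ N * (F'.filter fun b => c b = c a).card)
    {y : E l} {r : ℝ} (hr : ∀ a ∈ G, dist (f a) y ≤ r) :
    (Ncov δ (f '' G) : ℝ) * F.card ≤
      N * (F.filter fun a => dist (f a) y ≤ r + 2 * δ).card := by
  have h1 : Ncov δ (f '' G) ≤ (G.image c).card := by
    refine Ncov_le_card_of_cover hδ _ ?_
    rintro _ ⟨a, ha, rfl⟩
    exact ⟨c a, Finset.mem_image_of_mem c ha, hc a (hF' (hG ha))⟩
  have h2 : ∀ x ∈ G.image c, (F.card : ℝ) ≤ N * (F'.filter fun b => c b = x).card := by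
    intro x hx
    obtain ⟨a, ha, rfl⟩ := Finset.mem_image.1 hx
    exact hfib a (hG ha)
  have h3 : ((G.image c).card : ℝ) * F.card ≤
      N * ∑ x ∈ G.image c, ((F'.filter fun b => c b = x).card : ℝ) := by
    rw [Finset.mul_sum, ← nsmul_eq_mul, ← Finset.sum_const]
    exact Finset.sum_le_sum h2
  have h4 : ∑ x ∈ G.image c, (F'.filter fun b => c b = x).card ≤
      (F.filter fun a => dist (f a) y ≤ r + 2 * δ).card := by
    rw [← Finset.card_biUnion]
    · refine Finset.card_le_card fun b hb => ?_
      obtain ⟨x, hx, hbx⟩ := Finset.mem_biUnion.1 hb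
      obtain ⟨hbF, rfl⟩ := Finset.mem_filter.1 hbx
      obtain ⟨a, ha, hac⟩ := Finset.mem_image.1 hx
      refine Finset.mem_filter.2 ⟨hF' hbF, ?_⟩
      have e1 := hc b (hF' hbF)
      have e2 := hc a (hF' (hG ha))
      rw [hac] at e2
      have e3 := hr a ha
      have e4 := dist_triangle (f b) (f a) y
      have e5 := dist_triangle_right (f b) (f a) (c b)
      linarith
    · intro x _ x' _ hxx'
      refine Finset.disjoint_left.2 fun b hb hb' => hxx' ?_
      rw [← (Finset.mem_filter.1 hb).2, ← (Finset.mem_filter.1 hb').2]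
  calc (Ncov δ (f '' G) : ℝ) * F.card ≤ (G.image c).card * F.card := by gcongr
    _ ≤ _ := h3
    _ ≤ _ := by
      gcongr
      exact_mod_cast h4

/-- The grid bound for a subset of a slice along the first member of the family. -/
theorem card_le_of_slice {p : ℕ} (hδ : 0 < δ) (V : Fin (p + 2) → Gr n m) {C : ℝ} (hC : 0 ≤ C)
    (hV : ∀ a, ‖a‖ ≤ C * ∑ i, ‖(V i).proj a‖) {G : Finset (E n)}
    (hG : (G : Set (E n)).Pairwise fun a b => δ < dist a b) {x : E n}
    (hx : ∀ a ∈ G, dist ((V 0).proj a) x ≤ δ) {P Q : ℝ}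
    (hP : ∀ i, (Ncov δ ((V i).proj '' (G : Set (E n))) : ℝ) ≤ P)
    (hQ : (Ncov δ ((V 1).proj '' (G : Set (E n))) : ℝ) ≤ Q) :
    (G.card : ℝ) ≤ (1 + 4 * (p + 2) * C) ^ n * (Q * P ^ p) := by
  have hgrid := card_le_prod_Ncov hδ (R := C * ((p + 2) * (2 * δ))) (by positivity) G hG
    (fun i => (V i).proj) (by
      intro a _ b _ hab
      rw [dist_eq_norm]
      refine (hV (a - b)).trans (mul_le_mul_of_nonneg_left ?_ hC)
      have : ∀ i ∈ Finset.univ, ‖(V i).proj (a - b)‖ ≤ 2 * δ := fun i _ => by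
        rw [map_sub, ← dist_eq_norm]; exact hab i
      refine (Finset.sum_le_sum this).trans (le_of_eq ?_)
      rw [Finset.sum_const, Finset.card_univ, Fintype.card_fin, nsmul_eq_mul]
      push_cast
      ring)
  have e : 1 + 2 * (C * ((p + 2) * (2 * δ))) / δ = 1 + 4 * (p + 2) * C := by
    field_simp; ring
  rw [e] at hgrid
  refine hgrid.trans (mul_le_mul_of_nonneg_left ?_ (by positivity))
  rw [Fin.prod_univ_succ, Fin.prod_univ_succ]
  have h0 : (Ncov δ ((V 0).proj '' (G : Set (E n))) : ℝ) ≤ 1 := by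
    have : Ncov δ ((V 0).proj '' (G : Set (E n))) ≤ ({x} : Finset (E n)).card := by
      refine Ncov_le_card_of_cover hδ _ ?_
      rintro _ ⟨a, ha, rfl⟩
      exact ⟨x, Finset.mem_singleton_self x, hx a ha⟩
    exact_mod_cast this
  have hrest : ∏ i : Fin p, (Ncov δ ((V i.succ.succ).proj '' (G : Set (E n))) : ℝ) ≤ P ^ p := by
    refine (Finset.prod_le_prod (fun _ _ => Nat.cast_nonneg _) fun i _ => hP i.succ.succ).trans ?_
    rw [Finset.prod_const, Finset.card_univ, Fintype.card_fin]
  have hQ0 : 0 ≤ Q := (Nat.cast_nonneg _).trans hQ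
  have hprod0 : 0 ≤ ∏ i : Fin p, (Ncov δ ((V i.succ.succ).proj '' (G : Set (E n))) : ℝ) :=
    Finset.prod_nonneg fun _ _ => Nat.cast_nonneg _
  calc _ ≤ 1 * (Q * P ^ p) := by
        refine mul_le_mul h0 (mul_le_mul hQ hrest hprod0 hQ0) ?_ zero_le_one
        exact mul_nonneg (Nat.cast_nonneg _) hprod0
    _ = _ := one_mul _

/-- On a slice along `U`, the projection to the image of `V` needs about as many balls as the
projection to `V`. -/
theorem Ncov_proj_push_le (hδ : 0 < δ) {J : E l →ₗᵢ[ℝ] E n} {U : Gr n m} (hJ : Parametrizes J U)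
    (h : m + k = n) (hml : m ≤ l) {V : Gr n m} {W : Gr n k} (hUW : U.1 ≤ W.1) {ρ₀ : ℝ}
    (hρ₀ : 0 < ρ₀) (hV : ρ₀ ≤ dang h V W) (G : Finset (E n)) {x : E n}
    (hx : ∀ a ∈ G, dist (U.proj a) x ≤ δ) :
    (Ncov δ ((Gr.push hml J.toContinuousLinearMap.adjoint V).proj ''
      (J.toContinuousLinearMap.adjoint '' (G : Set (E n)))) : ℝ) ≤
      (1 + 8 / ρ₀) ^ l * Ncov δ (V.proj '' (G : Set (E n))) := by
  set T := J.toContinuousLinearMap.adjoint with hT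
  rw [← Set.image_comp]
  have key := Ncov_image_le hδ (R := 4 * δ / ρ₀) (by positivity) G V.proj
    ((Gr.push hml T V).proj ∘ T) (by
      intro a ha b hb hab
      rw [dist_eq_norm] at hab ⊢
      rw [Function.comp_apply, Function.comp_apply, ← map_sub, ← map_sub]
      rw [← map_sub] at hab
      rw [le_div_iff₀ hρ₀, mul_comm]
      have h1 := dang_mul_norm_push_le hJ h hml (V := V) hUW (T (a - b))
      have h2 : V.proj (J (T (a - b))) = V.proj (a - b) - V.proj (U.proj (a - b)) := by
        rw [hJ, map_sub]
      have h3 : ‖V.proj (U.proj (a - b))‖ ≤ 2 * δ := by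
        refine (Submodule.norm_starProjection_apply_le _ _).trans ?_
        rw [map_sub, ← dist_eq_norm]
        linarith [hx a ha, hx b hb, dist_triangle_right (U.proj a) (U.proj b) x]
      have h4 : ‖V.proj (J (T (a - b)))‖ ≤ 4 * δ := by
        rw [h2]
        linarith [norm_sub_le (V.proj (a - b)) (V.proj (U.proj (a - b)))]
      refine le_trans ?_ (h1.trans h4)
      exact mul_le_mul_of_nonneg_right hV (norm_nonneg _))
  have e : 1 + 2 * (4 * δ / ρ₀) / δ = 1 + 8 / ρ₀ := by field_simp; ring
  rwa [e] at key

/-! ### The induction step -/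

open Classical in
/-- A subset of `F` of comparable size whose fibres over the first two members of the family are
large. -/
theorem exists_regular_subset {p : ℕ} (hδ : 0 < δ) (V : Fin (p + 2) → Gr n m) (F : Finset (E n))
    {P : ℝ} (hP : ∀ i, (Ncov δ ((V i).proj '' (F : Set (E n))) : ℝ) ≤ P) :
    ∃ F₂ ⊆ F, (F.card : ℝ) ≤ 4 * F₂.card ∧ ∃ c : E n → E n,
      (∀ a ∈ F₂, dist ((V 0).proj a) (c a) ≤ δ) ∧
      (∀ a ∈ F₂, (F.card : ℝ) ≤ 4 * P * (F₂.filter fun b => c b = c a).card) ∧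
      ∀ G ⊆ F₂, ∀ y r, (∀ a ∈ G, dist ((V 1).proj a) y ≤ r) →
        (Ncov δ ((V 1).proj '' (G : Set (E n))) : ℝ) * F.card ≤
          2 * P * (F.filter fun a => dist ((V 1).proj a) y ≤ r + 2 * δ).card := by
  obtain ⟨c₁, hc₁, F₁, hF₁, hcard₁, hfib₁⟩ := exists_large_fibers hδ F (V 1).proj
  obtain ⟨c, hc, F₂, hF₂, hcard₂, hfib₂⟩ := exists_large_fibers hδ F₁ (V 0).proj
  have hP0 : 0 ≤ P := (Nat.cast_nonneg _).trans (hP 0)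
  refine ⟨F₂, hF₂.trans hF₁, by linarith, c, fun a ha => hc a (hF₂ ha), fun a ha => ?_,
    fun G hG y r hr => ?_⟩
  · have h1 : (Ncov δ ((V 0).proj '' (F₁ : Set (E n))) : ℝ) ≤ P := by
      refine le_trans ?_ (hP 0)
      exact Nat.cast_le.2 (Ncov_mono hδ (F.finite_toSet.image _).isBounded
        (Set.image_mono (Finset.coe_subset.2 hF₁)))
    have h2 := hfib₂ a ha
    have h3 : 2 * (Ncov δ ((V 0).proj '' (F₁ : Set (E n))) : ℝ) *
        (F₂.filter fun b => c b = c a).card ≤ 2 * P * (F₂.filter fun b => c b = c a).card :=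
      mul_le_mul_of_nonneg_right (mul_le_mul_of_nonneg_left h1 zero_le_two) (Nat.cast_nonneg _)
    linarith
  · refine Ncov_mul_card_le_of_large_fibers hδ hF₁ (hG.trans hF₂) hc₁ (by positivity)
      (fun a ha => (hfib₁ a ha).trans ?_) hr
    exact mul_le_mul_of_nonneg_right (mul_le_mul_of_nonneg_left (hP 1) zero_le_two)
      (Nat.cast_nonneg _)

/-- On a slice of a sufficiently separated set, `J*` keeps the points separated. -/
theorem two_mul_lt_dist_adjoint {J : E l →ₗᵢ[ℝ] E n} {U : Gr n m} (hJ : Parametrizes J U)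
    {a b x : E n} (ha : dist (U.proj a) x ≤ δ) (hb : dist (U.proj b) x ≤ δ)
    (hab : 4 * δ < dist a b) :
    2 * δ < dist (J.toContinuousLinearMap.adjoint a) (J.toContinuousLinearMap.adjoint b) := by
  set T := J.toContinuousLinearMap.adjoint with hT
  have h1 := hJ (a - b)
  have h2 : ‖U.proj (a - b)‖ ≤ 2 * δ := by
    rw [map_sub, ← dist_eq_norm]
    linarith [dist_triangle_right (U.proj a) (U.proj b) x]
  have h3 : ‖a - b‖ ≤ ‖J (T (a - b))‖ + ‖U.proj (a - b)‖ := by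
    rw [hJ]
    simpa using norm_add_le ((a - b) - U.proj (a - b)) (U.proj (a - b))
  rw [J.norm_map, map_sub, ← dist_eq_norm, ← dist_eq_norm] at h3
  linarith

theorem norm_adjoint_le (J : E l →ₗᵢ[ℝ] E n) (x : E n) :
    ‖J.toContinuousLinearMap.adjoint x‖ ≤ ‖x‖ := by
  refine (ContinuousLinearMap.le_opNorm _ _).trans (mul_le_of_le_one_left (norm_nonneg _) ?_)
  rw [LinearIsometryEquiv.norm_map]
  exact J.norm_toContinuousLinearMap_le

open Classical in
/-- Points of a slice whose images under `J*` lie in a ball of radius `ρ` are few: the tube over a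
ball in `V 1` is light, and the other projections are bounded by `P`. -/
theorem card_slice_filter_le {p : ℕ} (hδ : 0 < δ) (V : Fin (p + 2) → Gr n m) {C : ℝ} (hC : 0 ≤ C)
    (hV : ∀ a, ‖a‖ ≤ C * ∑ i, ‖(V i).proj a‖) {J : E l →ₗᵢ[ℝ] E n} (hJ : Parametrizes J (V 0))
    {F D : Finset (E n)} (hDF : D ⊆ F) (hF : (F : Set (E n)).Pairwise fun a b => 4 * δ < dist a b)
    {x : E n} (hx : ∀ a ∈ D, dist ((V 0).proj a) x ≤ δ) {P Q ρ : ℝ} (hQ : 0 ≤ Q)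
    (hP : ∀ i, (Ncov δ ((V i).proj '' (F : Set (E n))) : ℝ) ≤ P) (hρ : δ ≤ ρ)
    (hslim : ∀ G ⊆ D, ∀ y r, (∀ a ∈ G, dist ((V 1).proj a) y ≤ r) →
        (Ncov δ ((V 1).proj '' (G : Set (E n))) : ℝ) * F.card ≤
          2 * P * (F.filter fun a => dist ((V 1).proj a) y ≤ r + 2 * δ).card)
    (htube : ∀ y, ((F.filter fun a => dist ((V 1).proj a) y ≤ 6 * ρ).card : ℝ) ≤ Q * F.card)
    (y : E l) :
    ((D.filter fun a => dist (J.toContinuousLinearMap.adjoint a) y ≤ ρ).card : ℝ) ≤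
      (1 + 4 * (p + 2) * C) ^ n * (2 * Q * P ^ (p + 1)) := by
  set T := J.toContinuousLinearMap.adjoint with hT
  have hP0 : 0 ≤ P := (Nat.cast_nonneg _).trans (hP 0)
  set G := D.filter fun a => dist (T a) y ≤ ρ with hG
  have hGD : G ⊆ D := Finset.filter_subset _ _
  have hGF : G ⊆ F := hGD.trans hDF
  rcases G.eq_empty_or_nonempty with he | ⟨a₀, ha₀⟩
  · rw [he, Finset.card_empty, Nat.cast_zero]; positivity
  have hFc : (0 : ℝ) < F.card := by exact_mod_cast Finset.card_pos.2 ⟨a₀, hGF ha₀⟩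
  have hdiam : ∀ a ∈ G, dist ((V 1).proj a) ((V 1).proj a₀) ≤ 4 * ρ := by
    intro a ha
    have e1 := (Finset.mem_filter.1 ha).2
    have e2 := (Finset.mem_filter.1 ha₀).2
    have e3 := dist_triangle_right (T a) (T a₀) y
    have e4 := hx a (hGD ha)
    have e5 := hx a₀ (hGD ha₀)
    have e6 := dist_triangle_right ((V 0).proj a) ((V 0).proj a₀) x
    rw [dist_eq_norm, ← map_sub] at e3 e6 ⊢
    have e7 : ‖a - a₀‖ ≤ ‖J (T (a - a₀))‖ + ‖(V 0).proj (a - a₀)‖ := by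
      rw [hJ]
      simpa using norm_add_le ((a - a₀) - (V 0).proj (a - a₀)) ((V 0).proj (a - a₀))
    rw [J.norm_map] at e7
    have e8 : ‖(V 1).proj (a - a₀)‖ ≤ ‖a - a₀‖ := Submodule.norm_starProjection_apply_le _ _
    linarith
  have h1 := hslim G hGD _ _ hdiam
  have h2 : ((F.filter fun a => dist ((V 1).proj a) ((V 1).proj a₀) ≤ 4 * ρ + 2 * δ).card : ℝ) ≤
      Q * F.card := by
    refine le_trans ?_ (htube ((V 1).proj a₀))
    refine Nat.cast_le.2 (Finset.card_le_card ?_)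
    refine Finset.monotone_filter_right _ fun a _ ha => le_trans ha ?_
    linarith
  have h3 : (Ncov δ ((V 1).proj '' (G : Set (E n))) : ℝ) ≤ 2 * P * Q := by
    refine le_of_mul_le_mul_right (h1.trans ?_) hFc
    refine (mul_le_mul_of_nonneg_left h2 (mul_nonneg zero_le_two hP0)).trans (le_of_eq ?_)
    ring
  have hsep : (G : Set (E n)).Pairwise fun a b => δ < dist a b := by
    intro a ha b hb hab
    have := hF (hGF ha) (hGF hb) hab
    linarith
  have hPG : ∀ i, (Ncov δ ((V i).proj '' (G : Set (E n))) : ℝ) ≤ P := by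
    intro i
    refine le_trans ?_ (hP i)
    exact Nat.cast_le.2 (Ncov_mono hδ (F.finite_toSet.image _).isBounded
      (Set.image_mono (Finset.coe_subset.2 hGF)))
  refine (card_le_of_slice hδ V hC hV hsep (fun a ha => hx a (hGD ha)) hPG h3).trans (le_of_eq ?_)
  ring

open Classical in
/-- A set of large covering number without concentration contains a separated finite set with the
same properties, up to a loss in the exponent. -/
theorem exists_separated_regular_subset {α κ ε : ℝ} (hδ : 0 < δ) {A : Set (E n)}
    (hA1 : A ⊆ Metric.closedBall 0 1) (h17 : 17 ^ n ≤ δ ^ (-ε))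
    (hAcard : δ ^ (-α + ε) ≤ (Ncov δ A : ℝ))
    (hAball : ∀ ρ : ℝ, δ ≤ ρ → ∀ x : E n,
      (Ncov δ (A ∩ Metric.closedBall x ρ) : ℝ) ≤ δ ^ (-ε) * ρ ^ κ * (Ncov δ A : ℝ)) :
    ∃ A₀ : Finset (E n), (A₀ : Set (E n)) ⊆ A ∧
      ((A₀ : Set (E n)).Pairwise fun x y => 4 * δ < dist x y) ∧
      δ ^ (-α + 2 * ε) ≤ A₀.card ∧
      ∀ ρ, δ ≤ ρ → ∀ x, ((A₀.filter fun a => dist a x ≤ ρ).card : ℝ) ≤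
        δ ^ (-(2 * ε)) * ρ ^ κ * A₀.card := by
  have hpos : ∀ x : ℝ, 0 < δ ^ x := fun x => Real.rpow_pos_of_pos hδ x
  have hmul : ∀ x y : ℝ, δ ^ x * δ ^ y = δ ^ (x + y) := fun x y => (Real.rpow_add hδ x y).symm
  have hAbdd : Bornology.IsBounded A := Metric.isBounded_closedBall.subset hA1
  obtain ⟨A₀, hA₀A, hA₀sep, hA₀card⟩ := exists_separated_subset hδ hAbdd
  have hA₀card' : (Ncov δ A : ℝ) ≤ δ ^ (-ε) * A₀.card :=
    hA₀card.trans (mul_le_mul_of_nonneg_right h17 (Nat.cast_nonneg _))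
  refine ⟨A₀, hA₀A, hA₀sep, ?_, ?_⟩
  · calc δ ^ (-α + 2 * ε) = δ ^ (-α + ε) * δ ^ ε := by rw [hmul]; ring_nf
      _ ≤ δ ^ (-ε) * A₀.card * δ ^ ε :=
          mul_le_mul_of_nonneg_right (hAcard.trans hA₀card') (hpos _).le
      _ = (δ ^ (-ε) * δ ^ ε) * A₀.card := by ring
      _ = A₀.card := by rw [hmul, neg_add_cancel, Real.rpow_zero, one_mul]
  · intro ρ hρ x
    have hρκ : 0 < ρ ^ κ := Real.rpow_pos_of_pos (hδ.trans_le hρ) κ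
    have hsep : ((A₀.filter fun a => dist a x ≤ ρ : Finset (E n)) : Set (E n)).Pairwise
        fun x y => 2 * δ < dist x y := by
      intro a ha b hb hab
      have := hA₀sep (Finset.filter_subset _ _ ha) (Finset.filter_subset _ _ hb) hab
      linarith
    have h1 : ((A₀.filter fun a => dist a x ≤ ρ).card : ℝ) ≤
        Ncov δ (A ∩ Metric.closedBall x ρ) := by
      rw [← Ncov_eq_card hδ hsep]
      refine Nat.cast_le.2 (Ncov_mono hδ (hAbdd.subset Set.inter_subset_left) ?_)
      intro a ha
      obtain ⟨ha1, ha2⟩ := Finset.mem_filter.1 (Finset.mem_coe.1 ha)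
      exact ⟨hA₀A ha1, ha2⟩
    refine (h1.trans (hAball ρ hρ x)).trans ?_
    calc δ ^ (-ε) * ρ ^ κ * (Ncov δ A : ℝ) ≤ δ ^ (-ε) * ρ ^ κ * (δ ^ (-ε) * A₀.card) :=
          mul_le_mul_of_nonneg_left hA₀card' (mul_nonneg (hpos _).le hρκ.le)
      _ = (δ ^ (-ε) * δ ^ (-ε)) * ρ ^ κ * A₀.card := by ring
      _ = _ := by rw [hmul]; ring_nf

/-- For a family that is independent with constant `(2 / δ ^ γ) ^ (p + 2)`, the constant of the grid
bound costs only a small power of `δ`. -/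
theorem grid_constant_le {p : ℕ} {ε γ : ℝ} (hδ : 0 < δ) (hδ1 : δ ≤ 1) (hγ : 0 ≤ γ)
    (hK : 8 * (1 + 4 * (p + 2) * 2 ^ (p + 2)) ^ n ≤ δ ^ (-ε)) :
    8 * (1 + 4 * (p + 2) * (2 / δ ^ γ) ^ (p + 2)) ^ n ≤ δ ^ (-(ε + (p + 2) * n * γ)) := by
  have hρ₀ : 0 < δ ^ γ := Real.rpow_pos_of_pos hδ γ
  have h1 : (1 : ℝ) ≤ (1 / δ ^ γ) ^ (p + 2) := by
    refine one_le_pow₀ ?_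
    rw [le_div_iff₀ hρ₀, one_mul]
    exact Real.rpow_le_one hδ.le hδ1 hγ
  have h2 : (2 / δ ^ γ) ^ (p + 2) = 2 ^ (p + 2) * (1 / δ ^ γ) ^ (p + 2) := by
    rw [← mul_pow]; congr 1; ring
  have h3 : (1 : ℝ) + 4 * (p + 2) * (2 / δ ^ γ) ^ (p + 2) ≤
      (1 + 4 * (p + 2) * 2 ^ (p + 2)) * (1 / δ ^ γ) ^ (p + 2) := by
    rw [h2]; linarith
  have h4 : ((1 / δ ^ γ) ^ (p + 2)) ^ n = δ ^ (-((p + 2) * n * γ)) := by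
    rw [← pow_mul, one_div, ← Real.rpow_neg hδ.le, ← Real.rpow_mul_natCast hδ.le]
    push_cast; ring_nf
  calc 8 * (1 + 4 * (p + 2) * (2 / δ ^ γ) ^ (p + 2)) ^ n
      ≤ 8 * ((1 + 4 * (p + 2) * 2 ^ (p + 2)) * (1 / δ ^ γ) ^ (p + 2)) ^ n := by gcongr
    _ = (8 * (1 + 4 * (p + 2) * 2 ^ (p + 2)) ^ n) * δ ^ (-((p + 2) * n * γ)) := by
        rw [mul_pow, h4]; ring
    _ ≤ δ ^ (-ε) * δ ^ (-((p + 2) * n * γ)) :=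
        mul_le_mul_of_nonneg_right hK (Real.rpow_nonneg hδ.le _)
    _ = _ := by rw [← Real.rpow_add hδ]; ring_nf

theorem one_add_div_pow_le {ε γ : ℝ} (hδ : 0 < δ) (hδ1 : δ ≤ 1) (hγ : 0 ≤ γ)
    (h9 : 9 ^ l ≤ δ ^ (-ε)) : (1 + 8 / δ ^ γ) ^ l ≤ δ ^ (-(ε + l * γ)) := by
  have hρ₀ : 0 < δ ^ γ := Real.rpow_pos_of_pos hδ γ
  have e1 : 1 + 8 / δ ^ γ ≤ 9 * (1 / δ ^ γ) := by
    have : 1 ≤ 1 / δ ^ γ := by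
      rw [le_div_iff₀ hρ₀, one_mul]
      exact Real.rpow_le_one hδ.le hδ1 hγ
    have e : 8 / δ ^ γ = 8 * (1 / δ ^ γ) := by ring
    rw [e]; linarith
  calc (1 + 8 / δ ^ γ) ^ l ≤ (9 * (1 / δ ^ γ)) ^ l := by gcongr
    _ = 9 ^ l * δ ^ (-(l * γ)) := by
        rw [mul_pow, one_div, ← Real.rpow_neg hδ.le, ← Real.rpow_mul_natCast hδ.le]; ring_nf
    _ ≤ δ ^ (-ε) * δ ^ (-(l * γ)) := mul_le_mul_of_nonneg_right h9 (Real.rpow_nonneg hδ.le _)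
    _ = _ := by rw [← Real.rpow_add hδ]; ring_nf

/-- Comparison of the grid bound for a piece of a slice, with `w = ρ ^ (κ / 4)`, with the cardinality
`S` of the slice. -/
theorem grid_bound_le {p : ℕ} {β ε X η K w S : ℝ} (hδ : 0 < δ) (hδ1 : δ ≤ 1) (hK0 : 0 ≤ K)
    (hw : 0 ≤ w) (hS0 : 0 ≤ S) (hK : 8 * K ≤ δ ^ (-(ε + X)))
    (hS : δ ^ (-((p + 2) * β) + (p + 4) * ε) ≤ 4 * δ ^ (-β - ε) * S)
    (hη : X + (3 * (p + 2) + 7) * ε ≤ η) :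
    K * (2 * (δ ^ (-(4 * ε)) * w * δ ^ (-((p + 2) * ε))) * (δ ^ (-β - ε)) ^ (p + 1)) ≤
      δ ^ (-η) * w * S := by
  have hpos : ∀ x : ℝ, 0 < δ ^ x := fun x => Real.rpow_pos_of_pos hδ x
  have hmul : ∀ x y : ℝ, δ ^ x * δ ^ y = δ ^ (x + y) := fun x y => (Real.rpow_add hδ x y).symm
  set P := δ ^ (-β - ε) with hP
  have hP0 : 0 < P := hpos _
  have hPp : P ^ (p + 2) = δ ^ (-((p + 2) * β) - (p + 2) * ε) := by
    rw [hP, ← Real.rpow_mul_natCast hδ.le]; push_cast; ring_nf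
  have e1 := hpos (-(4 * ε))
  have e2 := hpos (-((p + 2) * ε))
  have e3 := hpos ((p + 2) * β - (p + 4) * ε)
  have h2 : 1 ≤ δ ^ ((p + 2) * β - (p + 4) * ε) * (4 * P * S) :=
    calc 1 = δ ^ ((p + 2) * β - (p + 4) * ε) * δ ^ (-((p + 2) * β) + (p + 4) * ε) := by
          rw [hmul]; ring_nf; rw [Real.rpow_zero]
      _ ≤ _ := mul_le_mul_of_nonneg_left hS e3.le
  calc K * (2 * (δ ^ (-(4 * ε)) * w * δ ^ (-((p + 2) * ε))) * P ^ (p + 1))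
      ≤ K * (2 * (δ ^ (-(4 * ε)) * w * δ ^ (-((p + 2) * ε))) * P ^ (p + 1)) *
        (δ ^ ((p + 2) * β - (p + 4) * ε) * (4 * P * S)) :=
        le_mul_of_one_le_right (by positivity) h2
    _ = 8 * K * (δ ^ (-(4 * ε)) * δ ^ (-((p + 2) * ε)) *
          P ^ (p + 2) * δ ^ ((p + 2) * β - (p + 4) * ε)) * w * S := by ring
    _ ≤ δ ^ (-(ε + X)) * (δ ^ (-(4 * ε)) * δ ^ (-((p + 2) * ε)) *
          P ^ (p + 2) * δ ^ ((p + 2) * β - (p + 4) * ε)) * w * S := by gcongr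
    _ = δ ^ (-(X + (3 * (p + 2) + 7) * ε)) * w * S := by
        rw [hPp, hmul, hmul, hmul, hmul]; ring_nf
    _ ≤ δ ^ (-η) * w * S := by
        have := Real.rpow_le_rpow_of_exponent_ge hδ hδ1 (neg_le_neg hη)
        gcongr

set_option maxHeartbeats 1000000 in
open Classical in
theorem projectionTheorem_of_slice {p k : ℕ} (hp : 0 < p) (hm : 0 < m) (hn : (p + 2) * m = n)
    (h : m + l = n) (hk : m + k = l) (hl : (p + 1) * m = l)
    (hP : ProjectionTheorem l m) : ProjectionTheorem n m := by
  obtain rfl : l = n - m := by omega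
  set l := n - m
  intro _ hmn α κ hα hαn hκ
  have hk0 : 0 < k := by
    have : k = p * m := by
      have e : (p + 1) * m = p * m + m := by ring
      omega
    rw [this]; positivity
  have hml : m ≤ l := by omega
  have hq0 : (0 : ℝ) < p + 2 := by positivity
  have hm0 : (0 : ℝ) < m := by exact_mod_cast hm
  have hnR : (n : ℝ) = (p + 2) * m := by rw [← hn]; push_cast; ring
  have hlR : (l : ℝ) = (p + 1) * m := by rw [← hl]; push_cast; ring
  set β := α / (p + 2) with hβ
  have hβ0 : 0 < β := by positivity
  have hαβ : α = (p + 2) * β := by rw [hβ]; field_simp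
  have hβm : β < m := by
    rw [hβ, div_lt_iff₀ hq0]; linarith
  obtain ⟨η, hη, hstrong⟩ := hP.measure_EC_le hk hm hk0 (α := (p + 1) * β) (κ := κ / 4)
    (by positivity) (by rw [hlR]; gcongr) (by positivity)
  -- `L` collects all the losses in the exponent
  set L : ℝ := 3 * (p + 2) * n / κ + 3 * (p + 2) + 20 with hL
  have hL0 : 0 < L := by positivity
  set ε := min (η / L) (κ / 3) with hε
  have hε0 : 0 < ε := lt_min (by positivity) (by positivity)
  have hLε : L * ε ≤ η := by
    have : ε ≤ η / L := min_le_left _ _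
    rw [le_div_iff₀ hL0] at this
    linarith
  have hεκ : 3 * ε / κ ≤ 1 := by
    have : ε ≤ κ / 3 := min_le_right _ _
    rw [div_le_one hκ]; linarith
  set γ := 3 * ε / κ with hγ
  have hγ0 : 0 < γ := by positivity
  have hLexp : L * ε = (p + 2) * n * γ + (3 * (p + 2) + 20) * ε := by
    rw [hL, hγ]; field_simp; ring
  have hX0 : 0 ≤ (p + 2) * n * γ := by positivity
  have hpε : 0 ≤ (p : ℝ) * ε := by positivity
  have hbudget : (p + 2) * n * γ + (3 * (p + 2) + 20) * ε ≤ η := by rw [← hLexp]; exact hLε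
  have hev : ∀ᶠ δ in 𝓝[>] (0 : ℝ), ∀ (A : Set (E n)) (μ : Measure (Gr n m)),
      A ⊆ Metric.closedBall 0 1 → IsProbabilityMeasure μ → δ ^ (-α + ε) ≤ (Ncov δ A : ℝ) →
      (∀ ρ : ℝ, δ ≤ ρ → ∀ x : E n,
        (Ncov δ (A ∩ Metric.closedBall x ρ) : ℝ) ≤ δ ^ (-ε) * ρ ^ κ * (Ncov δ A : ℝ)) →
      (∀ ρ : ℝ, δ ≤ ρ → ∀ W : Gr n l, μ.real (Vang h W ρ) ≤ δ ^ (-ε) * ρ ^ κ) →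
      ∃ A' ⊆ A, μ.real (EC δ α A' ε) ≤ δ ^ ε := by
    filter_upwards [self_mem_nhdsWithin, Ioo_mem_nhdsGT one_pos, hstrong,
      -- tubes of radius `6 ρ ≥ 4 ρ + 2 δ` are needed in `card_slice_filter_le`
      eventually_exists_no_heavy_tube h hm hε0 hκ (c := 6) (by norm_num),
      eventually_le_rpow_neg (17 ^ n) hε0, eventually_le_rpow_neg 6 hε0,
      eventually_le_rpow_neg (8 * (1 + 4 * (p + 2) * 2 ^ (p + 2)) ^ n) hε0,
      eventually_le_rpow_neg (9 ^ l) hε0] with δ hδ hδ1 hB htubes h17 h6 hK h9 A μ hA1 hμ hAcard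
      hAball hang
    replace hδ : 0 < δ := hδ
    have hδ1 : δ < 1 := hδ1.2
    have hpos : ∀ x : ℝ, 0 < δ ^ x := fun x => Real.rpow_pos_of_pos hδ x
    have hanti : ∀ {x y : ℝ}, x ≤ y → δ ^ y ≤ δ ^ x := fun hxy =>
      Real.rpow_le_rpow_of_exponent_ge hδ hδ1.le hxy
    have hmul : ∀ x y : ℝ, δ ^ x * δ ^ y = δ ^ (x + y) := fun x y => (Real.rpow_add hδ x y).symm
    have hpow : ∀ (x : ℝ) (j : ℕ), (δ ^ x) ^ j = δ ^ (x * j) := fun x j =>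
      (Real.rpow_mul_natCast hδ.le x j).symm
    have hcancel : ∀ x : ℝ, δ ^ (-x) * δ ^ x = 1 := fun x => by
      rw [hmul, neg_add_cancel, Real.rpow_zero]
    by_contra! hcon
    obtain ⟨A₀, hA₀A, hA₀sep, hA₀big, hA₀ball⟩ :=
      exists_separated_regular_subset hδ hA1 h17 hAcard hAball
    have hsep2 : ∀ F ⊆ A₀, (F : Set (E n)).Pairwise fun x y => 2 * δ < dist x y := by
      intro F hF x hx y hy hxy
      have := hA₀sep (hF hx) (hF hy) hxy
      linarith
    have hN : ∀ F ⊆ A₀, Ncov δ (F : Set (E n)) = F.card := fun F hF => Ncov_eq_card hδ (hsep2 F hF)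
    have hA₀ne : A₀.Nonempty := Finset.card_pos.1 (by exact_mod_cast (hpos _).trans_le hA₀big)
    obtain ⟨Bad, hBad, htube⟩ := htubes A₀ μ hA₀ne hμ hA₀ball hang
    -- with this `ρ₀`, the directions at an angle at most `ρ₀` with a given `W` have measure at most
    -- `δ ^ (2 ε)`, less than the measure of the exceptional directions
    set ρ₀ := δ ^ γ with hρ₀
    have hρ₀pos : 0 < ρ₀ := hpos γ
    have hρ₀1 : ρ₀ ≤ 1 := Real.rpow_le_one hδ.le hδ1.le hγ0.le
    have hδρ₀ : δ ≤ ρ₀ := by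
      conv_lhs => rw [← Real.rpow_one δ]
      exact hanti hεκ
    have hVang : ∀ W : Gr n l, μ.real (Vang h W ρ₀) ≤ δ ^ (2 * ε) := by
      intro W
      refine (hang ρ₀ hδρ₀ W).trans (le_of_eq ?_)
      rw [hρ₀, ← Real.rpow_mul hδ.le, hmul]
      congr 1
      rw [hγ]; field_simp; ring
    have h2ε : 6 * δ ^ (2 * ε) ≤ δ ^ ε := by
      calc 6 * δ ^ (2 * ε) ≤ δ ^ (-ε) * δ ^ (2 * ε) := by have := hpos (2 * ε); gcongr
        _ = δ ^ ε := by rw [hmul]; ring_nf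
    have hexp : -((m : ℝ) / (n : ℝ)) * α - ε = -β - ε := by
      rw [hnR, hαβ]; field_simp
    set P := δ ^ (-β - ε) with hPdef
    have hP0 : 0 < P := hpos _
    -- a quantitatively independent family of exceptional directions for one large subset
    obtain ⟨V, F, hFA₀, hFcard, hgood, -, hindep⟩ := exists_quantitatively_independent h hρ₀pos
      hρ₀1 (hpos ε).le
      (fun V F => (Ncov δ (V.proj '' (F : Set (E n))) : ℝ) < P ∧ V ∉ Bad)
      (fun V F F' hF' hg => ⟨lt_of_le_of_lt (Nat.cast_le.2 (Ncov_mono hδ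
        (F.finite_toSet.image _).isBounded (Set.image_mono (by exact_mod_cast hF')))) hg.1, hg.2⟩)
      A₀ (by
        intro F hF W
        have h1 := hcon F (subset_trans (by exact_mod_cast hF) hA₀A)
        have h2 : ¬ (EC δ α (F : Set (E n)) ε : Set (Gr n m)) ⊆ Vang h W ρ₀ ∪ Bad := by
          intro hsub
          have h3 := (measureReal_mono hsub).trans (measureReal_union_le (μ := μ) _ _)
          linarith [hVang W, hpos (2 * ε)]
        obtain ⟨V, hVEC, hV⟩ := Set.not_subset.1 h2
        rw [Set.mem_union, not_or] at hV
        obtain ⟨A', hA'F, hA'card, hA'proj⟩ := hVEC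
        refine ⟨V, (not_le.1 hV.1).le, F.filter fun a => a ∈ A', Finset.filter_subset _ _, ?_⟩
        have hY : ((F.filter fun a => a ∈ A' : Finset (E n)) : Set (E n)) = A' := by
          ext a; simp only [Finset.coe_filter, Set.mem_ofPred_eq]
          exact ⟨fun hh => hh.2, fun hh => ⟨hA'F hh, hh⟩⟩
        rw [hN F hF, ← hY, hN _ ((Finset.filter_subset _ _).trans hF)] at hA'card
        refine ⟨hA'card, ?_, hV.2⟩
        rw [hY, hPdef, ← hexp]
        exact hA'proj)
      (p + 2) (by
        have e : (p + 2) * m = (p + 1) * m + m := by ring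
        omega)
    set C := (2 / ρ₀) ^ (p + 2) with hC
    have hC0 : 0 ≤ C := by positivity
    have hV := norm_le_sum_proj hn V hindep
    have hPF : ∀ i, (Ncov δ ((V i).proj '' (F : Set (E n))) : ℝ) ≤ P := fun i => (hgood i).1.le
    have hFcard' : (A₀.card : ℝ) ≤ δ ^ (-((p + 2) * ε)) * F.card := by
      rw [hpow] at hFcard
      calc (A₀.card : ℝ) = δ ^ (-((p + 2) * ε)) * δ ^ ((p + 2) * ε) * A₀.card := by
            rw [hcancel, one_mul]
        _ = δ ^ (-((p + 2) * ε)) * (δ ^ (ε * ((p + 2 : ℕ) : ℝ)) * A₀.card) := by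
            push_cast
            rw [mul_assoc]
            ring_nf
        _ ≤ _ := mul_le_mul_of_nonneg_left hFcard (hpos _).le
    have hFbig : δ ^ (-α + (p + 4) * ε) ≤ F.card := by
      calc δ ^ (-α + (p + 4) * ε) = δ ^ ((p + 2) * ε) * δ ^ (-α + 2 * ε) := by
            rw [hmul]; ring_nf
        _ ≤ δ ^ ((p + 2) * ε) * (δ ^ (-((p + 2) * ε)) * F.card) :=
            mul_le_mul_of_nonneg_left (hA₀big.trans hFcard') (hpos _).le
        _ = F.card := by
            rw [← mul_assoc, hmul, add_neg_cancel, Real.rpow_zero, one_mul]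
    obtain ⟨F₂, hF₂F, hF₂card, c, hc, hfib, hslim⟩ := exists_regular_subset hδ V F hPF
    have hF₂A₀ : F₂ ⊆ A₀ := hF₂F.trans hFA₀
    have hF₂ne : F₂.Nonempty := by
      rw [← Finset.card_pos]
      have : (0 : ℝ) < F₂.card := by linarith [(hpos _).trans_le hFbig]
      exact_mod_cast this
    -- slices along `U = V 0`
    obtain ⟨J, hJ⟩ := exists_parametrizes h (V 0)
    obtain ⟨W₀, hW₀⟩ := exists_superspace (k := l) (V 0).1 (by rw [(V 0).2]; exact hml) (by omega)
    set T := J.toContinuousLinearMap.adjoint with hT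
    set Φ : Gr n m → Gr l m := Gr.push hml T with hΦ
    have hΦm : Measurable Φ := Gr.measurable_push hml T
    let part : E n → Finset (E n) := fun x => F₂.filter fun a => c a = x
    let B : E n → Finset (E l) := fun x => (part x).image T
    have hpartF₂ : ∀ x, part x ⊆ F₂ := fun x => Finset.filter_subset _ _
    have hpartx : ∀ x, ∀ a ∈ part x, dist ((V 0).proj a) x ≤ δ := by
      intro x a ha
      obtain ⟨ha1, rfl⟩ := Finset.mem_filter.1 ha
      exact hc a ha1
    have hTsep : ∀ x, ∀ a ∈ part x, ∀ b ∈ part x, a ≠ b → 2 * δ < dist (T a) (T b) := by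
      intro x a ha b hb hab
      exact two_mul_lt_dist_adjoint hJ (hpartx x a ha) (hpartx x b hb)
        (hA₀sep (hF₂A₀ (hpartF₂ x ha)) (hF₂A₀ (hpartF₂ x hb)) hab)
    have hTinj : ∀ x, Set.InjOn T (part x : Set (E n)) := by
      intro x a ha b hb hab
      by_contra hne
      have := hTsep x a ha b hb hne
      rw [hab, dist_self] at this
      linarith
    have hBsep : ∀ x, (B x : Set (E l)).Pairwise fun y z => 2 * δ < dist y z := by
      intro x y hy z hz hyz
      obtain ⟨a, ha, rfl⟩ := Finset.mem_image.1 (Finset.mem_coe.1 hy)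
      obtain ⟨b, hb, rfl⟩ := Finset.mem_image.1 (Finset.mem_coe.1 hz)
      exact hTsep x a ha b hb fun e => hyz (by rw [e])
    have hBcard : ∀ x, (B x).card = (part x).card := fun x =>
      Finset.card_image_of_injOn (hTinj x)
    have hpartF : ∀ x ∈ F₂.image c, (F.card : ℝ) ≤ 4 * P * (part x).card := by
      intro x hx
      obtain ⟨a, ha, rfl⟩ := Finset.mem_image.1 hx
      exact hfib a ha
    have hslices : ∀ x ∈ F₂.image c,
        (μ.map Φ).real (EC δ ((p + 1) * β) (B x : Set (E l)) η) ≤ δ ^ η := by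
      intro x hx
      refine hB (B x) (μ.map Φ) ?_ (Measure.isProbabilityMeasure_map hΦm.aemeasurable) (hBsep x)
        ?_ ?_ ?_
      · intro y hy
        obtain ⟨a, ha, rfl⟩ := Finset.mem_image.1 (Finset.mem_coe.1 hy)
        have h1 := hA1 (hA₀A (hF₂A₀ (hpartF₂ x ha)))
        rw [mem_closedBall_zero_iff] at h1 ⊢
        exact (norm_adjoint_le J a).trans h1
      · rw [hBcard]
        have h1 := hFbig.trans (hpartF x hx)
        have h2 : δ ^ (-α + (p + 4) * ε) = δ ^ (-((p + 1) * β) + (p + 5) * ε) * P := by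
          rw [hPdef, hmul, hαβ]; ring_nf
        rw [h2] at h1
        have h3 : δ ^ (-((p + 1) * β) + (p + 5) * ε) ≤ 4 * (part x).card := by
          refine le_of_mul_le_mul_right ?_ hP0
          linarith
        have h4 : δ ^ (-((p + 1) * β) + η) ≤
            δ ^ (-((p + 1) * β) + (p + 5) * ε) * δ ^ ε := by
          rw [hmul]
          exact hanti (by linarith)
        have h5 : 4 * δ ^ ε ≤ 1 := by
          calc 4 * δ ^ ε ≤ δ ^ (-ε) * δ ^ ε :=
                mul_le_mul_of_nonneg_right (by linarith) (hpos ε).le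
            _ = 1 := hcancel ε
        calc _ ≤ _ := h4
          _ ≤ 4 * (part x).card * δ ^ ε := mul_le_mul_of_nonneg_right h3 (hpos ε).le
          _ = 4 * δ ^ ε * (part x).card := by ring
          _ ≤ 1 * (part x).card := mul_le_mul_of_nonneg_right h5 (Nat.cast_nonneg _)
          _ = _ := one_mul _
      · intro ρ hρ y
        have hρ0 : 0 < ρ := hδ.trans_le hρ
        have hρκ : 0 < ρ ^ (κ / 4) := Real.rpow_pos_of_pos hρ0 _
        rcases le_total 1 ρ with hρ1 | hρ1
        · have h1 : 1 ≤ δ ^ (-η) := Real.one_le_rpow_of_pos_of_le_one_of_nonpos hδ hδ1.le (by linarith)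
          have h2 : 1 ≤ ρ ^ (κ / 4) := Real.one_le_rpow hρ1 (by positivity)
          have h3 : (((B x).filter fun a => dist a y ≤ ρ).card : ℝ) ≤ (B x).card :=
            Nat.cast_le.2 (Finset.card_le_card (Finset.filter_subset _ _))
          refine h3.trans (le_mul_of_one_le_left (Nat.cast_nonneg _) ?_)
          exact one_le_mul_of_one_le_of_one_le h1 h2
        · set Q := δ ^ (-(4 * ε)) * ρ ^ (κ / 4) * δ ^ (-((p + 2) * ε)) with hQ
          have hQ0 : 0 ≤ Q := mul_nonneg (mul_nonneg (hpos _).le hρκ.le) (hpos _).le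
          have hcardG : (((B x).filter fun a => dist a y ≤ ρ).card : ℝ) ≤
              ((part x).filter fun a => dist (T a) y ≤ ρ).card := by
            refine Nat.cast_le.2 ?_
            rw [Finset.filter_image]
            exact Finset.card_image_le
          have hG := card_slice_filter_le hδ V hC0 hV hJ ((hpartF₂ x).trans hF₂F)
            (hA₀sep.mono (by exact_mod_cast hFA₀)) (hpartx x) hQ0 hPF hρ
            (fun G hG => hslim G (hG.trans (hpartF₂ x)))
            (fun z => by
              have h1 := htube (V 1) (hgood 1).2 ρ hρ hρ1 z
              have h2 : ((F.filter fun a => dist ((V 1).proj a) z ≤ 6 * ρ).card : ℝ) ≤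
                  (A₀.filter fun a => dist ((V 1).proj a) z ≤ 6 * ρ).card :=
                Nat.cast_le.2 (Finset.card_le_card (Finset.filter_subset_filter _ hFA₀))
              refine (h2.trans h1).trans ?_
              rw [hQ, mul_assoc (δ ^ (-(4 * ε)) * ρ ^ (κ / 4))]
              exact mul_le_mul_of_nonneg_left hFcard' (mul_nonneg (hpos _).le hρκ.le)) y
          refine (hcardG.trans hG).trans ?_
          rw [hBcard]
          refine grid_bound_le hδ hδ1.le (by positivity) hρκ.le (Nat.cast_nonneg _)
            (grid_constant_le hδ hδ1.le hγ0.le hK) ?_ (by linarith)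
          rw [← hαβ]
          exact hFbig.trans (hpartF x hx)
      · intro ρ hρ W'
        have hρ0 : 0 < ρ := hδ.trans_le hρ
        rw [map_measureReal_apply hΦm (isClosed_Vang hk W' ρ).measurableSet]
        rcases le_total 1 ρ with hρ1 | hρ1
        · have h1 : 1 ≤ δ ^ (-η) := Real.one_le_rpow_of_pos_of_le_one_of_nonpos hδ hδ1.le (by linarith)
          have h2 : 1 ≤ ρ ^ (κ / 4) := Real.one_le_rpow hρ1 (by positivity)
          exact measureReal_le_one.trans (one_le_mul_of_one_le_of_one_le h1 h2)
        · obtain ⟨W, hW⟩ := exists_preimage_Vang_subset hJ h hk hml W'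
          refine (measureReal_mono (hW ρ hρ0.le)).trans ((hang ρ hρ W).trans ?_)
          have h1 : δ ^ (-ε) ≤ δ ^ (-η) := hanti (by linarith)
          have h2 : ρ ^ κ ≤ ρ ^ (κ / 4) :=
            Real.rpow_le_rpow_of_exponent_ge hρ0 hρ1 (by linarith)
          exact mul_le_mul h1 h2 (Real.rpow_nonneg hρ0.le _) (hpos _).le
    -- exceptional directions for `F₂` are exceptional for many slices
    have hfinal := measureReal_le_of_parts μ F₂ hF₂ne (F₂.image c) part
      (by
        intro x _ x' _ hxx'
        refine Finset.disjoint_left.2 fun b hb hb' => hxx' ?_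
        rw [← (Finset.mem_filter.1 hb).2, ← (Finset.mem_filter.1 hb').2])
      (fun x _ => hpartF₂ x) (t := δ ^ ε) (η := δ ^ η) (hpos ε) (hpos η).le
      (by
        have : F₂ \ (F₂.image c).biUnion part = ∅ := by
          rw [Finset.sdiff_eq_empty_iff_subset]
          intro a ha
          exact Finset.mem_biUnion.2 ⟨c a, Finset.mem_image_of_mem c ha,
            Finset.mem_filter.2 ⟨ha, rfl⟩⟩
        rw [this, Finset.card_empty, Nat.cast_zero]
        exact mul_nonneg (half_pos (hpos ε)).le (Nat.cast_nonneg _))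
      (fun x => Φ ⁻¹' EC δ ((p + 1) * β) (B x : Set (E l)) η)
      (fun x hx => by
        refine le_trans ?_ (hslices x hx)
        have := Measure.isProbabilityMeasure_map (μ := μ) hΦm.aemeasurable
        exact ENNReal.toReal_mono (measure_ne_top _ _)
          (Measure.le_map_apply hΦm.aemeasurable _))
      (EC δ α (F₂ : Set (E n)) ε \ Vang h W₀ ρ₀)
      (by
        rintro V' ⟨⟨A', hA'F, hA'card, hA'proj⟩, hV'⟩
        have hdang : ρ₀ ≤ dang h V' W₀ := (not_le.1 hV').le
        set Y := F₂.filter fun a => a ∈ A' with hYdef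
        have hYF₂ : Y ⊆ F₂ := Finset.filter_subset _ _
        have hY : (Y : Set (E n)) = A' := by
          ext a; simp only [hYdef, Finset.coe_filter, Set.mem_ofPred_eq]
          exact ⟨fun hh => hh.2, fun hh => ⟨hA'F hh, hh⟩⟩
        rw [hN F₂ hF₂A₀, ← hY, hN Y (hYF₂.trans hF₂A₀)] at hA'card
        refine ⟨Y, hYF₂, hA'card, fun x hx hYx => ?_⟩
        have hsub : Y ∩ part x ⊆ part x := Finset.inter_subset_right
        have hL2 : (l * γ + 6 * ε) ≤ η := by
          have hln : (l : ℝ) ≤ (p + 2) * n := by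
            have e : (l : ℝ) ≤ n := by rw [hnR, hlR]; gcongr; norm_num
            have e0 : (0 : ℝ) ≤ p * n := by positivity
            have e1 : (0 : ℝ) ≤ n := by positivity
            linarith
          have e2 : (l : ℝ) * γ ≤ (p + 2) * n * γ := by gcongr
          linarith
        have hlγ : 0 ≤ (l : ℝ) * γ := by positivity
        refine ⟨((Y ∩ part x).image T : Finset (E l)), ?_, ?_, ?_⟩
        · exact_mod_cast Finset.image_subset_image hsub
        · rw [Ncov_eq_card hδ (hBsep x), Ncov_eq_card hδ ((hBsep x).mono (by
            exact_mod_cast Finset.image_subset_image hsub)), hBcard,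
            Finset.card_image_of_injOn ((hTinj x).mono (by exact_mod_cast hsub))]
          refine le_trans (mul_le_mul_of_nonneg_right ?_ (Nat.cast_nonneg _)) hYx
          calc δ ^ η ≤ δ ^ (2 * ε) := hanti (by linarith)
            _ ≤ δ ^ ε / 4 := by linarith [hpos (2 * ε)]
        · rw [Finset.coe_image]
          have h1 := Ncov_proj_push_le hδ hJ h hml hW₀ hρ₀pos hdang (Y ∩ part x)
            (fun a ha => hpartx x a (hsub ha))
          have h2 : (Ncov δ (V'.proj '' ((Y ∩ part x : Finset (E n)) : Set (E n))) : ℝ) ≤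
              Ncov δ (V'.proj '' A') := by
            rw [← hY]
            exact Nat.cast_le.2 (Ncov_mono hδ (Y.finite_toSet.image _).isBounded
              (Set.image_mono (by exact_mod_cast Finset.inter_subset_left)))
          have h3 : (1 + 8 / ρ₀) ^ l ≤ δ ^ (-(ε + l * γ)) :=
            one_add_div_pow_le hδ hδ1.le hγ0.le h9
          have hexp' : -((m : ℝ) / (l : ℝ)) * ((p + 1) * β) - η = -β - η := by
            rw [hlR]; field_simp
          rw [hexp']
          rw [hexp] at hA'proj
          calc _ ≤ (1 + 8 / ρ₀) ^ l *
                Ncov δ (V'.proj '' ((Y ∩ part x : Finset (E n)) : Set (E n))) := h1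
            _ ≤ (1 + 8 / ρ₀) ^ l * Ncov δ (V'.proj '' A') :=
                mul_le_mul_of_nonneg_left h2 (by positivity)
            _ < (1 + 8 / ρ₀) ^ l * P := mul_lt_mul_of_pos_left hA'proj (by positivity)
            _ ≤ δ ^ (-(ε + l * γ)) * P := mul_le_mul_of_nonneg_right h3 hP0.le
            _ = δ ^ (-β - (2 * ε + l * γ)) := by rw [hPdef, hmul]; ring_nf
            _ ≤ δ ^ (-β - η) := hanti (by linarith))
    have hEC := hcon F₂ (subset_trans (by exact_mod_cast hF₂A₀) hA₀A)
    have hcover : (EC δ α (F₂ : Set (E n)) ε : Set (Gr n m)) ⊆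
        (EC δ α (F₂ : Set (E n)) ε \ Vang h W₀ ρ₀) ∪ Vang h W₀ ρ₀ := by
      intro V' hV'
      by_cases hmem : V' ∈ Vang h W₀ ρ₀
      · exact Or.inr hmem
      · exact Or.inl ⟨hV', hmem⟩
    have h1 := (measureReal_mono hcover).trans (measureReal_union_le (μ := μ) _ _)
    have h2 : 4 * δ ^ η / δ ^ ε ≤ 4 * δ ^ (2 * ε) := by
      rw [div_le_iff₀ (hpos ε), mul_assoc, hmul]
      have : δ ^ η ≤ δ ^ (2 * ε + ε) := hanti (by linarith)
      linarith
    linarith [hVang W₀, hpos (2 * ε)]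
  obtain ⟨δ₀, hδ₀, hsub⟩ := (mem_nhdsGT_iff_exists_Ioo_subset).1 hev
  exact ⟨ε, hε0, δ₀, hδ₀, fun δ hδ hδδ₀ => hsub ⟨hδ, hδδ₀⟩⟩

end HigherRankProjection

theorem proposition8 (q m : ℕ) (hq : 3 ≤ q) (hm : 0 < m)
    (h : HigherRankProjection.ProjectionTheorem ((q - 1) * m) m) :
    HigherRankProjection.ProjectionTheorem (q * m) m := by
  obtain ⟨p, rfl⟩ : ∃ p, q = p + 2 := ⟨q - 2, by omega⟩
  rw [show p + 2 - 1 = p + 1 by omega] at h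
  exact HigherRankProjection.projectionTheorem_of_slice (p := p) (k := p * m) (l := (p + 1) * m)
    (by omega) hm rfl (by ring) (by ring) rfl h
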